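/- Let $b_0,k_0>0$, let $k_m,k_s\in L^\infty([0,2\pi])$ be real-valued, and for $N\in\mathbb N$ put $\rho_0=N/(2\pi)$ and $a_0^2=k_0/\rho_0^2$. For $\varepsilon\ge 0$ consider the mistuned equation $$v_{tt}+b_0v_t=a_0^2v_{xx}+\varepsilon\Big[\frac{k_m}{\rho_0}v_x+\frac{k_s}{2\rho_0^2}v_{xx}\Big],\qquad v(0,t)=v(2\pi,t)=0 .$$ A number $s\in\mathbb C$ is an eigenvalue if there is a nonzero $\eta\in H^2(0,2\pi)$ with $\eta(0)=\eta(2\pi)=0$ and $$s^2\eta+b_0s\eta=a_0^2\eta''+\varepsilon\Big[\frac{k_m}{\rho_0}\eta'+\frac{k_s}{2\rho_0^2}\eta''\Big]\quad\text{a.e.}$$ For $l\ge1$ put $s_l^\pm(0)=\tfrac12\big(-b_0\pm\sqrt{b_0^2-a_0^2l^2}\big)$, and let $$c_l(N)=\frac{l}{2b_0N}\int_0^{2\pi}k_m(x)\sin(lx)\,dx .$$ **Theorem.** Fix $b_0,k_0,k_m,k_s$ and $l\ge 1$. There are $\varepsilon_0>0$, $N_0\ge1$ and $C>0$ such that the following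 holds for every $N\ge N_0$. 1. There are unique continuous functions $\varepsilon\mapsto s_l^\pm(\varepsilon)\in\mathbb C$ on $[0,\varepsilon_0]$ that start from $s_l^\pm(0)$ and whose value at each $\varepsilon$ is an eigenvalue (unique also on every shorter interval $[0,\varepsilon_1]$, $0<\varepsilon_1\le\varepsilon_0$). The same is true with $k_s$ replaced by $0$; call the resulting functions $t_l^\pm(\varepsilon)$. 2. For all $\varepsilon\in[0,\varepsilon_0]$, $$\big|s_l^+(\varepsilon)-\varepsilon c_l(N)\big|\le C\varepsilon^2+\frac{C}{N^2},\qquad \big|s_l^-(\varepsilon)-\big(-b_0-\varepsilon c_l(N)\big)\big|\le C\varepsilon^2+\frac{C}{N^2}.$$ 3. There are real numbers $r^\pm=r^\pm(N)$ with $|r^+-c_l(N)|\le C/N^2$, $|r^-+c_l(N)|\le C/N^2$ and $$\big|s_l^\pm(\varepsilon)-s_l^\pm(0)-\varepsilon r^\pm\big|\le C\varepsilon^2\qquad\text{for all }\varepsilon\in[0,\varepsilon_0].$$ 4. The perturbation $k_s$ enters the part of first order in $\varepsilon$ only at order $1/N^2$: for all $\varepsilon\in[0,\varepsilon_0]$,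 $$\big|s_l^\pm(\varepsilon)-t_l^\pm(\varepsilon)\big|\le \frac{C\varepsilon}{N^2}+C\varepsilon^2 .$$ -/

import Mathlib

open Real Set MeasureTheory

namespace Platoon

noncomputable section

/-- Mean density `ρ₀ = N / (2π)` of a platoon of `N` vehicles. -/
def meanDensity (N : ℕ) : ℝ := N / (2 * π)

/-- Squared wave speed `a₀² = k₀ / ρ₀²`. -/
def waveSpeedSq (k₀ : ℝ) (N : ℕ) : ℝ := k₀ / meanDensity N ^ 2

/-- The function `η` lies in the Sobolev space `H²(0, 2π)` of complex-valued functions (and is its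
continuously differentiable representative), with first derivative `η₁` and second weak
derivative `η₂`: in one dimension this means that `η` is the integral of `η₁`, and `η₁` is
the integral of `η₂ ∈ L²(0, 2π)`. -/
structure IsSobolevH2 (η η₁ η₂ : ℝ → ℂ) : Prop where
  memLp_two : MemLp η₂ 2 (volume.restrict (Icc 0 (2 * π)))
  eq_integral : ∀ x ∈ Icc 0 (2 * π), η x = η 0 + ∫ t in (0 : ℝ)..x, η₁ t
  eq_integral' : ∀ x ∈ Icc 0 (2 * π), η₁ x = η₁ 0 + ∫ t in (0 : ℝ)..x, η₂ t

/-- `s ∈ ℂ` is an eigenvalue of the mistuned equation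
`v_tt + b₀ v_t = a₀² v_xx + ε [ (k_m / ρ₀) v_x + (k_s / (2 ρ₀²)) v_xx ]` on `[0, 2π]` with
Dirichlet boundary conditions: there is a nonzero `η ∈ H²(0, 2π)`, vanishing at `0` and `2π`,
such that `v(x, t) = e^{st} η(x)` solves the equation, that is,
`s² η + b₀ s η = a₀² η'' + ε [ (k_m / ρ₀) η' + (k_s / (2 ρ₀²)) η'' ]` almost everywhere. -/
def IsDirichletEigenvalue (b₀ k₀ : ℝ) (km ks : ℝ → ℝ) (N : ℕ) (ε : ℝ) (s : ℂ) : Prop :=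
  ∃ η η₁ η₂ : ℝ → ℂ, IsSobolevH2 η η₁ η₂ ∧ η 0 = 0 ∧ η (2 * π) = 0 ∧
    (∃ x ∈ Icc 0 (2 * π), η x ≠ 0) ∧
    ∀ᵐ x ∂(volume.restrict (Icc 0 (2 * π))),
      s ^ 2 * η x + b₀ * s * η x =
        (waveSpeedSq k₀ N : ℂ) * η₂ x +
          ε * (((km x / meanDensity N : ℝ) : ℂ) * η₁ x +
            ((ks x / (2 * meanDensity N ^ 2) : ℝ) : ℂ) * η₂ x)

/-- Nominal (`ε = 0`) eigenvalue `s_l^+ = (-b₀ + √(b₀² - a₀² l²)) / 2`, with the principal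
complex square root. -/
def nominalPlus (b₀ k₀ : ℝ) (N l : ℕ) : ℂ :=
  (-(b₀ : ℂ) + ((b₀ ^ 2 - waveSpeedSq k₀ N * (l : ℝ) ^ 2 : ℝ) : ℂ) ^ (1 / 2 : ℂ)) / 2

/-- Nominal (`ε = 0`) eigenvalue `s_l^- = (-b₀ - √(b₀² - a₀² l²)) / 2`, with the principal
complex square root. -/
def nominalMinus (b₀ k₀ : ℝ) (N l : ℕ) : ℂ :=
  (-(b₀ : ℂ) - ((b₀ ^ 2 - waveSpeedSq k₀ N * (l : ℝ) ^ 2 : ℝ) : ℂ) ^ (1 / 2 : ℂ)) / 2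

/-- `s` is a continuous branch, over `ε ∈ [0, E]`, of eigenvalues of the mistuned Dirichlet
problem which starts from the value `s₀` at `ε = 0`. -/
structure IsEigenvalueBranch (b₀ k₀ : ℝ) (km ks : ℝ → ℝ) (N : ℕ) (s₀ : ℂ) (E : ℝ)
    (s : ℝ → ℂ) : Prop where
  continuousOn : ContinuousOn s (Icc 0 E)
  start : s 0 = s₀
  isEigenvalue : ∀ ε ∈ Icc 0 E, IsDirichletEigenvalue b₀ k₀ km ks N ε (s ε)

/-- `s` is the continuous eigenvalue branch over `[0, E]` starting from `s₀`: it is such a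
branch, and every such branch over a shorter interval `[0, E']` coincides with it there. -/
structure IsTheEigenvalueBranch (b₀ k₀ : ℝ) (km ks : ℝ → ℝ) (N : ℕ) (s₀ : ℂ) (E : ℝ)
    (s : ℝ → ℂ) : Prop where
  isBranch : IsEigenvalueBranch b₀ k₀ km ks N s₀ E s
  unique : ∀ E' : ℝ, 0 < E' → E' ≤ E → ∀ t : ℝ → ℂ,
    IsEigenvalueBranch b₀ k₀ km ks N s₀ E' t → EqOn t s (Icc 0 E')

/-- The coefficient `(l / (2 b₀ N)) ∫₀^{2π} k_m(x) sin(l x) dx`. -/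
def mistuningCoeff (b₀ : ℝ) (km : ℝ → ℝ) (N l : ℕ) : ℝ :=
  (l : ℝ) / (2 * b₀ * N) * ∫ x in (0 : ℝ)..(2 * π), km x * Real.sin (l * x)

end

end Platoon

/-! With `ρ = N / (2π)` and `A = k₀ + ε k_s / 2`, multiplying the eigenvalue equation by `ρ²` gives
`A η'' + ε ρ k_m η' = -lam η` with `lam = -ρ² (s² + b₀ s)`. This is a Sturm-Liouville problem, so
`lam` is real (Wronskian of real and imaginary part), and `s` is recovered from `lam` as a root of a
quadratic.

In Prüfer coordinates `η = r sin θ`, `η' = κ r cos θ` with `κ = l / 2`, the angle solves a scalar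
equation, and `lam` is admissible exactly when `θ(2π)` is a multiple of `π`. The end angle is
strictly increasing in `lam` and continuous in `(ε, lam)`, so `θ(2π) = l π` has exactly one solution
`ν(ε)`, continuous in `ε`, with `ν(0) = k₀ κ²`. Along any continuous branch of eigenvalues the end
angle is continuous with values in the discrete set `π ℤ`, hence constant; this identifies its
spectral parameter with `ν`. The sign of the square root cannot change while the discriminant is
positive. This is existence and uniqueness of the branches.

Near the nominal problem `θ' = κ`, the end angle expands to first order with a quadratic error
(`abs_sub_first_order_le`), whence `ν(ε) = k₀ κ² + ε ρ a + ε b + O((ε ρ)²)` with `a` linear in `k_m`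
and `b` linear in `k_s` (`exists_spectralBranch`). The constant is uniform in `ρ ≥ 1` and in all
admissible `ε`: a large `ε ρ` is covered by an a priori bound on `ν` of order `1 + (ε ρ)²`. This is
why `ε₀` need not shrink with `N`: only `ν / ρ²` enters `s = (-b₀ ± √(b₀² - 4 ν / ρ²)) / 2`, and
after division by `ρ²` the error is `O(ε²)`.

A Taylor bound for the square root then gives the linear rates `∓ (a / ρ + b / ρ²) / √D₀` with `√D₀
= b₀ + O(1 / ρ²)`. The main part `∓ a / (ρ b₀)` is `± c_l(N)`, and `k_s` enters only through `b /
ρ²`. -/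

namespace Platoon

/-! ### Absolutely continuous functions and scalar linear equations -/

/-- A function is absolutely continuous as soon as it agrees on the interval with one that is. -/
theorem absolutelyContinuousOnInterval_congr {f g : ℝ → ℝ} {a b : ℝ}
    (hf : AbsolutelyContinuousOnInterval f a b) (h : EqOn g f (uIcc a b)) :
    AbsolutelyContinuousOnInterval g a b := by
  rw [absolutelyContinuousOnInterval_iff] at hf ⊢
  intro ε hε
  obtain ⟨δ, hδ, H⟩ := hf ε hε
  refine ⟨δ, hδ, fun E hE hlen => ?_⟩
  rw [Finset.sum_congr rfl fun i hi => ?_]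
  · exact H E hE hlen
  · rw [h (hE.1 i hi).1, h (hE.1 i hi).2]

/-- The composition of a Lipschitz function with an absolutely continuous one. -/
theorem absolutelyContinuousOnInterval_lipschitz_comp {f F : ℝ → ℝ} {a b : ℝ} {s : Set ℝ}
    {K : NNReal} (hF : LipschitzOnWith K F s) (hf : AbsolutelyContinuousOnInterval f a b)
    (hs : MapsTo f (uIcc a b) s) : AbsolutelyContinuousOnInterval (fun x => F (f x)) a b := by
  rw [absolutelyContinuousOnInterval_iff] at hf ⊢
  intro ε hε
  -- `K + 1` rather than `K`, since the Lipschitz constant may be zero.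
  obtain ⟨δ, hδ, H⟩ := hf (ε / (K + 1)) (by positivity)
  refine ⟨δ, hδ, fun E hE hlen => ?_⟩
  have h1 := H E hE hlen
  calc ∑ i ∈ Finset.range E.1, dist (F (f (E.2 i).1)) (F (f (E.2 i).2))
      ≤ ∑ i ∈ Finset.range E.1, (K + 1) * dist (f (E.2 i).1) (f (E.2 i).2) := by
        refine Finset.sum_le_sum fun i hi => ?_
        refine (hF.dist_le_mul _ (hs (hE.1 i hi).1) _ (hs (hE.1 i hi).2)).trans ?_
        gcongr
        linarith
    _ = (K + 1) * ∑ i ∈ Finset.range E.1, dist (f (E.2 i).1) (f (E.2 i).2) := by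
        rw [Finset.mul_sum]
    _ < (K + 1) * (ε / (K + 1)) := by gcongr
    _ = ε := by field_simp

/-- `f` is absolutely continuous on `[0, T]` with almost everywhere derivative `f'`. -/
structure HasACDeriv (T : ℝ) (f f' : ℝ → ℝ) : Prop where
  ac : AbsolutelyContinuousOnInterval f 0 T
  deriv : ∀ᵐ x, x ∈ uIcc 0 T → HasDerivAt f (f' x) x

namespace HasACDeriv

variable {T : ℝ} {f f' g g' h : ℝ → ℝ}

theorem continuousOn (hf : HasACDeriv T f f') (hT : 0 ≤ T) : ContinuousOn f (Icc 0 T) := by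
  have := hf.ac.continuousOn
  rwa [uIcc_of_le hT] at this

theorem congr_deriv (hf : HasACDeriv T f f') (h : ∀ᵐ x, x ∈ uIcc 0 T → f' x = g' x) :
    HasACDeriv T f g' := by
  refine ⟨hf.ac, ?_⟩
  filter_upwards [hf.deriv, h] with x h1 h2 hx
  exact h2 hx ▸ h1 hx

theorem congr_deriv' (hf : HasACDeriv T f f') (h : ∀ x, f' x = g' x) : HasACDeriv T f g' :=
  hf.congr_deriv (Filter.Eventually.of_forall fun x _ => h x)

theorem add (hf : HasACDeriv T f f') (hg : HasACDeriv T g g') :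
    HasACDeriv T (fun x => f x + g x) (fun x => f' x + g' x) := by
  refine ⟨hf.ac.add hg.ac, ?_⟩
  filter_upwards [hf.deriv, hg.deriv] with x h1 h2 hx
  exact (h1 hx).add (h2 hx)

theorem sub (hf : HasACDeriv T f f') (hg : HasACDeriv T g g') :
    HasACDeriv T (fun x => f x - g x) (fun x => f' x - g' x) := by
  refine ⟨hf.ac.sub hg.ac, ?_⟩
  filter_upwards [hf.deriv, hg.deriv] with x h1 h2 hx
  exact (h1 hx).sub (h2 hx)

theorem mul (hf : HasACDeriv T f f') (hg : HasACDeriv T g g') :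
    HasACDeriv T (fun x => f x * g x) (fun x => f' x * g x + f x * g' x) := by
  refine ⟨hf.ac.mul hg.ac, ?_⟩
  filter_upwards [hf.deriv, hg.deriv] with x h1 h2 hx
  exact (h1 hx).mul (h2 hx)

theorem const_mul (c : ℝ) (hf : HasACDeriv T f f') :
    HasACDeriv T (fun x => c * f x) (fun x => c * f' x) := by
  refine ⟨hf.ac.const_mul c, ?_⟩
  filter_upwards [hf.deriv] with x h1 hx
  exact (h1 hx).const_mul c

/-- An absolutely continuous function is bounded, and a `C¹` function is Lipschitz on the compact
interval containing its values. -/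
theorem comp {F F' : ℝ → ℝ} (hF : ContDiff ℝ 1 F) (hF' : ∀ y, HasDerivAt F (F' y) y)
    (hf : HasACDeriv T f f') : HasACDeriv T (fun x => F (f x)) (fun x => F' (f x) * f' x) := by
  refine ⟨?_, ?_⟩
  · obtain ⟨C, hC⟩ := hf.ac.exists_bound
    obtain ⟨K, hK⟩ := hF.contDiffOn.exists_lipschitzOnWith (s := Icc (-C) C) (by decide)
      (convex_Icc _ _) isCompact_Icc
    exact absolutelyContinuousOnInterval_lipschitz_comp hK hf.ac
      fun x hx => abs_le.mp (hC x hx)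
  · filter_upwards [hf.deriv] with x h1 hx
    exact (hF' _).comp x (h1 hx)

theorem of_contDiff {F F' : ℝ → ℝ} (hF : ContDiff ℝ 1 F) (hF' : ∀ y, HasDerivAt F (F' y) y) :
    HasACDeriv T F F' :=
  ⟨hF.contDiffOn.absolutelyContinuousOnInterval, Filter.Eventually.of_forall fun x _ => hF' x⟩

theorem of_const (c : ℝ) : HasACDeriv T (fun _ => c) (fun _ => 0) :=
  of_contDiff contDiff_const fun y => hasDerivAt_const y c

theorem of_integral (hg : IntervalIntegrable g volume 0 T) :
    HasACDeriv T (fun x => ∫ t in (0 : ℝ)..x, g t) g := by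
  refine ⟨hg.absolutelyContinuousOnInterval_intervalIntegral (by simp), ?_⟩
  filter_upwards [hg.ae_hasDerivAt_integral] with x hx h
  exact hx h 0 (by simp)

/-- Agreement on `[0, T]` gives agreement near every interior point; the two endpoints, where the
derivative may be lost, form a null set. -/
theorem congr (hT : 0 ≤ T) (hf : HasACDeriv T f f') (h : EqOn g f (Icc 0 T)) :
    HasACDeriv T g f' := by
  refine ⟨absolutelyContinuousOnInterval_congr hf.ac (by rwa [uIcc_of_le hT]), ?_⟩
  have h0 : ∀ᵐ x : ℝ, x ≠ 0 := by simp [ae_iff, measure_singleton]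
  have h1 : ∀ᵐ x : ℝ, x ≠ T := by simp [ae_iff, measure_singleton]
  filter_upwards [hf.deriv, h0, h1] with x hx hx0 hx1 hxT
  refine (hx hxT).congr_of_eventuallyEq ?_
  rw [uIcc_of_le hT] at hxT
  filter_upwards [Icc_mem_nhds (lt_of_le_of_ne hxT.1 hx0.symm) (lt_of_le_of_ne hxT.2 hx1)]
    with y hy using h hy

theorem of_eq_integral (hT : 0 ≤ T) (hg : IntervalIntegrable g volume 0 T)
    (h : ∀ x ∈ Icc 0 T, f x = f 0 + ∫ t in (0 : ℝ)..x, g t) : HasACDeriv T f g :=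
  (((of_const (f 0)).add (of_integral hg)).congr hT h).congr_deriv' fun x => by simp

theorem ae_deriv_eq (hf : HasACDeriv T f f') : ∀ᵐ x, x ∈ uIcc 0 T → f' x = _root_.deriv f x := by
  filter_upwards [hf.deriv] with x hx h using (hx h).deriv.symm

theorem intervalIntegrable (hf : HasACDeriv T f f') : IntervalIntegrable f' volume 0 T := by
  refine hf.ac.intervalIntegrable_deriv.congr_ae ?_
  rw [Filter.EventuallyEq, ae_restrict_iff' measurableSet_uIoc]
  filter_upwards [hf.ae_deriv_eq] with x hx h using (hx (uIoc_subset_uIcc h)).symm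

theorem mono (hf : HasACDeriv T f f') {x : ℝ} (hx : x ∈ uIcc 0 T) : HasACDeriv x f f' := by
  have hs : uIcc 0 x ⊆ uIcc 0 T := uIcc_subset_uIcc left_mem_uIcc hx
  refine ⟨hf.ac.mono hs, ?_⟩
  filter_upwards [hf.deriv] with y hy h using hy (hs h)

theorem integral_eq_sub (hf : HasACDeriv T f f') : ∫ t in (0 : ℝ)..T, f' t = f T - f 0 := by
  rw [← hf.ac.integral_deriv_eq_sub]
  refine intervalIntegral.integral_congr_ae ?_
  filter_upwards [hf.ae_deriv_eq] with x hx h using hx (uIoc_subset_uIcc h)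

/-- Variation of constants for a scalar linear equation `f' = g f + h`. -/
theorem exp_mul_eq (hg : IntervalIntegrable g volume 0 T)
    (hf : HasACDeriv T f (fun x => g x * f x + h x)) :
    exp (-∫ t in (0 : ℝ)..T, g t) * f T =
      f 0 + ∫ x in (0 : ℝ)..T, exp (-∫ t in (0 : ℝ)..x, g t) * h x := by
  have h1 : HasACDeriv T (fun x => exp (-∫ t in (0 : ℝ)..x, g t))
      (fun x => - (g x * exp (-∫ t in (0 : ℝ)..x, g t))) := by
    have h2 := ((of_integral hg).const_mul (-1)).comp (F := exp) (F' := exp)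
      Real.contDiff_exp Real.hasDerivAt_exp
    simp only [neg_mul, one_mul] at h2
    exact h2.congr_deriv' fun x => by ring
  have h3 := ((h1.mul hf).congr_deriv'
    (g' := fun x => exp (-∫ t in (0 : ℝ)..x, g t) * h x) fun x => by ring).integral_eq_sub
  rw [h3]
  simp

/-- Solutions of the homogeneous equation `f' = g f`. -/
theorem eq_mul_exp (hT : 0 ≤ T) (hg : IntervalIntegrable g volume 0 T)
    (hf : HasACDeriv T f (fun x => g x * f x)) {x : ℝ} (hx : x ∈ Icc 0 T) :
    f x = f 0 * exp (∫ t in (0 : ℝ)..x, g t) := by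
  have hx' : x ∈ uIcc 0 T := by rwa [uIcc_of_le hT]
  have h1 := (((hf.mono hx').congr_deriv' (g' := fun x => g x * f x + 0)
    fun x => by simp)).exp_mul_eq (h := fun _ => 0)
    (hg.mono_set (uIcc_subset_uIcc left_mem_uIcc hx'))
  simp only [mul_zero, intervalIntegral.integral_zero, add_zero] at h1
  rw [← h1, mul_right_comm, ← Real.exp_add]
  simp

end HasACDeriv

/-! ### The Prüfer equation and existence of its solutions -/

theorem intervalIntegrable_of_measurable_of_bounded {f : ℝ → ℝ} {C : ℝ} (hf : Measurable f)
    (hC : ∀ x, |f x| ≤ C) (a b : ℝ) : IntervalIntegrable f volume a b := by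
  refine (intervalIntegrable_const (c := C)).mono_fun hf.aestronglyMeasurable ?_
  filter_upwards with x
  rw [Real.norm_eq_abs, Real.norm_eq_abs]
  exact (hC x).trans (le_abs_self C)

/-- The right hand side of the Prüfer equation
`θ' = κ cos² θ + P sin θ cos θ + Q sin² θ` for the system `η = r sin θ`, `η' = κ r cos θ`
attached to `η'' = -P η' - κ Q η`. -/
noncomputable def pruferField (κ : ℝ) (P Q : ℝ → ℝ) (x θ : ℝ) : ℝ :=
  κ * cos θ ^ 2 + P x * (sin θ * cos θ) + Q x * sin θ ^ 2

/-- The factor `sin (β - α)` gives a Lipschitz bound in the angle and lets the difference of two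
Prüfer angles be treated as the solution of a linear equation. -/
theorem pruferField_sub (κ : ℝ) (P Q : ℝ → ℝ) (x α β : ℝ) :
    pruferField κ P Q x β - pruferField κ P Q x α =
      sin (β - α) * (P x * cos (α + β) + (Q x - κ) * sin (α + β)) := by
  rw [pruferField, pruferField, sin_sub, cos_add, sin_add]
  linear_combination
    (P x * (sin α * cos α) + (Q x - κ) * sin α ^ 2 + κ) * sin_sq_add_cos_sq β
      - (P x * (sin β * cos β) + (Q x - κ) * sin β ^ 2 + κ) * sin_sq_add_cos_sq α

theorem abs_pruferField_le {κ M : ℝ} {P Q : ℝ → ℝ} (x θ : ℝ) (hP : |P x| ≤ M)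
    (hQ : |Q x| ≤ M) : |pruferField κ P Q x θ| ≤ |κ| + 2 * M := by
  have h1 : |κ * cos θ ^ 2| ≤ |κ| := by
    rw [abs_mul, abs_of_nonneg (sq_nonneg (cos θ))]
    exact mul_le_of_le_one_right (abs_nonneg _) (cos_sq_le_one θ)
  have h2 : |P x * (sin θ * cos θ)| ≤ M := by
    rw [abs_mul, abs_mul]
    exact (mul_le_of_le_one_right (abs_nonneg _) (mul_le_one₀ (abs_sin_le_one θ) (abs_nonneg _)
      (abs_cos_le_one θ))).trans hP
  have h3 : |Q x * sin θ ^ 2| ≤ M := by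
    rw [abs_mul, abs_of_nonneg (sq_nonneg (sin θ))]
    exact (mul_le_of_le_one_right (abs_nonneg _) (sin_sq_le_one θ)).trans hQ
  exact (abs_add_three _ _ _).trans (by linarith)

theorem abs_pruferSlope_le {κ M : ℝ} {P Q : ℝ → ℝ} (x α : ℝ) (hP : |P x| ≤ M)
    (hQ : |Q x| ≤ M) : |P x * cos α + (Q x - κ) * sin α| ≤ |κ| + 2 * M := by
  have h1 : |P x * cos α| ≤ M := by
    rw [abs_mul]
    exact (mul_le_of_le_one_right (abs_nonneg _) (abs_cos_le_one α)).trans hP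
  have h2 : |(Q x - κ) * sin α| ≤ M + |κ| := by
    rw [abs_mul]
    exact (mul_le_of_le_one_right (abs_nonneg _) (abs_sin_le_one α)).trans
      ((abs_sub _ _).trans (by linarith))
  exact (abs_add_le _ _).trans (by linarith)

theorem abs_pruferField_sub_le {κ M : ℝ} {P Q : ℝ → ℝ} (x α β : ℝ) (hP : |P x| ≤ M)
    (hQ : |Q x| ≤ M) :
    |pruferField κ P Q x β - pruferField κ P Q x α| ≤ (|κ| + 2 * M) * |β - α| := by
  rw [pruferField_sub, abs_mul, mul_comm]
  have h := abs_pruferSlope_le (κ := κ) x (α + β) hP hQ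
  exact mul_le_mul h abs_sin_le_abs (abs_nonneg _) ((abs_nonneg _).trans h)

theorem measurable_pruferField {κ : ℝ} {P Q θ : ℝ → ℝ} (hP : Measurable P) (hQ : Measurable Q)
    (hθ : Measurable θ) : Measurable fun x => pruferField κ P Q x (θ x) := by
  unfold pruferField
  fun_prop

/-- `θ` is the Prüfer angle on `[0, T]` starting from `0`. -/
structure IsPruferAngle (T κ : ℝ) (P Q θ : ℝ → ℝ) : Prop where
  zero : θ 0 = 0
  hasACDeriv : HasACDeriv T θ fun x => pruferField κ P Q x (θ x)

/-- Bounded measurable coefficients have a Prüfer angle. -/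
theorem exists_isPruferAngle {T κ M : ℝ} {P Q : ℝ → ℝ} (hT : 0 ≤ T) (hκ : 0 < κ)
    (hPm : Measurable P) (hQm : Measurable Q) (hP : ∀ x, |P x| ≤ M) (hQ : ∀ x, |Q x| ≤ M) :
    ∃ θ, IsPruferAngle T κ P Q θ := by
  have hM : 0 ≤ M := (abs_nonneg _).trans (hP 0)
  set L : ℝ := |κ| + 2 * M with hL
  have hLpos : 0 < L := by positivity
  -- The unknown is `ψ = exp (-2 L t) θ`. In this weighted norm the Picard map contracts by `1 / 2`
  -- on the whole interval at once, whatever `T` is.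
  let ext (ψ : C(Icc 0 T, ℝ)) (t : ℝ) : ℝ := exp (2 * L * t) * ψ (projIcc 0 T hT t)
  have ext_cont (ψ : C(Icc 0 T, ℝ)) : Continuous (ext ψ) := by
    have := (ψ.continuous.comp (continuous_projIcc (h := hT)))
    exact (by fun_prop : Continuous fun t : ℝ => exp (2 * L * t)).mul this
  have hint (ψ : C(Icc 0 T, ℝ)) (a b : ℝ) :
      IntervalIntegrable (fun t => pruferField κ P Q t (ext ψ t)) volume a b :=
    intervalIntegrable_of_measurable_of_bounded
      (measurable_pruferField hPm hQm (ext_cont ψ).measurable)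
      (fun x => abs_pruferField_le x _ (hP x) (hQ x)) a b
  let Φ (ψ : C(Icc 0 T, ℝ)) : C(Icc 0 T, ℝ) :=
    ⟨fun x => exp (-(2 * L * x)) * ∫ t in (0 : ℝ)..x, pruferField κ P Q t (ext ψ t), by
      have := intervalIntegral.continuous_primitive (hint ψ) 0
      fun_prop⟩
  have hΦ : ContractingWith (1 / 2) Φ := by
    refine ⟨by rw [← NNReal.coe_lt_coe]; norm_num, LipschitzWith.of_dist_le_mul fun ψ₁ ψ₂ => ?_⟩
    rw [ContinuousMap.dist_le (by positivity)]
    intro x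
    have hx := x.2
    have h1 : |∫ t in (0 : ℝ)..x, (pruferField κ P Q t (ext ψ₁ t) - pruferField κ P Q t (ext ψ₂ t))|
        ≤ ∫ t in (0 : ℝ)..x, L * (exp (2 * L * t) * dist ψ₁ ψ₂) := by
      rw [← Real.norm_eq_abs]
      refine intervalIntegral.norm_integral_le_of_norm_le hx.1 ?_
        (by apply Continuous.intervalIntegrable; fun_prop)
      refine Filter.Eventually.of_forall fun t _ => ?_
      rw [Real.norm_eq_abs]
      refine (abs_pruferField_sub_le t _ _ (hP t) (hQ t)).trans ?_
      rw [hL]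
      gcongr
      simp only [ext, ← mul_sub, abs_mul, abs_of_pos (exp_pos _)]
      gcongr
      exact ContinuousMap.dist_apply_le_dist (f := ψ₁) (g := ψ₂) _
    have h2 : ∫ t in (0 : ℝ)..x, L * (exp (2 * L * t) * dist ψ₁ ψ₂)
        = (exp (2 * L * x) - 1) / 2 * dist ψ₁ ψ₂ := by
      have h3 : ∀ t ∈ uIcc (0 : ℝ) x, HasDerivAt (fun t => exp (2 * L * t) / 2 * dist ψ₁ ψ₂)
          (L * (exp (2 * L * t) * dist ψ₁ ψ₂)) t := fun t _ => by
        have := ((((hasDerivAt_id t).const_mul (2 * L)).exp).div_const 2).mul_const (dist ψ₁ ψ₂)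
        simp only [id_eq, mul_one] at this
        convert! this using 1
        ring
      rw [intervalIntegral.integral_eq_sub_of_hasDerivAt h3
        (by apply Continuous.intervalIntegrable; fun_prop)]
      simp
      ring
    rw [Real.dist_eq]
    simp only [Φ, ContinuousMap.coe_mk]
    rw [← mul_sub, ← intervalIntegral.integral_sub (hint _ _ _) (hint _ _ _), abs_mul,
      abs_of_pos (exp_pos _)]
    calc exp (-(2 * L * x)) * _
        ≤ exp (-(2 * L * x)) * ((exp (2 * L * x) - 1) / 2 * dist ψ₁ ψ₂) := by
          gcongr
          exact h1.trans h2.le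
      _ = (1 - exp (-(2 * L * x))) / 2 * dist ψ₁ ψ₂ := by
          rw [exp_neg]
          field_simp
      _ ≤ 1 / 2 * dist ψ₁ ψ₂ := by
          gcongr
          linarith [exp_pos (-(2 * L * x))]
      _ = _ := by norm_num
  set ψ := ContractingWith.fixedPoint Φ hΦ with hψ
  have hfix : Φ ψ = ψ := hΦ.fixedPoint_isFixedPt
  have key : ∀ x ∈ Icc 0 T, ext ψ x = ∫ t in (0 : ℝ)..x, pruferField κ P Q t (ext ψ t) := by
    intro x hx
    have h1 : Φ ψ ⟨x, hx⟩ = ψ ⟨x, hx⟩ := by rw [hfix]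
    simp only [Φ, ContinuousMap.coe_mk] at h1
    have h2 : ext ψ x = exp (2 * L * x) * ψ ⟨x, hx⟩ := by
      simp only [ext, projIcc_of_mem hT hx]
    rw [h2, ← h1, ← mul_assoc, ← exp_add]
    simp
  have h0 : ext ψ 0 = 0 := by rw [key 0 ⟨le_rfl, hT⟩]; simp
  exact ⟨ext ψ, h0, .of_eq_integral hT (hint ψ 0 T) fun x hx => by rw [h0, zero_add, key x hx]⟩

/-! ### Comparison of two Prüfer angles -/

section Comparison

variable {T κ M : ℝ} {P₁ Q₁ P₂ Q₂ θ₁ θ₂ : ℝ → ℝ}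

/-- The difference of two solutions of Prüfer equations solves a linear equation with bounded
coefficients; this is the resulting formula, with a weight `E` bounded above and below. -/
theorem exists_weight_mul_sub_eq (hT : 0 ≤ T)
    (hP₁m : Measurable P₁) (hQ₁m : Measurable Q₁)
    (hP₁ : ∀ x, |P₁ x| ≤ M) (hQ₁ : ∀ x, |Q₁ x| ≤ M)
    (h₁ : HasACDeriv T θ₁ fun x => pruferField κ P₁ Q₁ x (θ₁ x))
    (h₂ : HasACDeriv T θ₂ fun x => pruferField κ P₂ Q₂ x (θ₂ x)) :
    ∃ E : ℝ → ℝ, ContinuousOn E (Icc 0 T) ∧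
      (∀ x ∈ Icc 0 T, exp (-((|κ| + 2 * M) * T)) ≤ E x ∧ E x ≤ exp ((|κ| + 2 * M) * T)) ∧
      E T * (θ₂ T - θ₁ T) = (θ₂ 0 - θ₁ 0) + ∫ x in (0 : ℝ)..T,
        E x * ((P₂ x - P₁ x) * (sin (θ₂ x) * cos (θ₂ x)) + (Q₂ x - Q₁ x) * sin (θ₂ x) ^ 2) := by
  have c₁ : ContinuousOn θ₁ (uIcc 0 T) := h₁.ac.continuousOn
  have c₂ : ContinuousOn θ₂ (uIcc 0 T) := h₂.ac.continuousOn
  have hM : 0 ≤ M := (abs_nonneg _).trans (hP₁ 0)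
  -- Writing `sin w = sinc w * w` for `w = θ₂ - θ₁` turns the difference equation into `w' = g w +
  -- h` with `g` bounded, without division where the angles coincide. The weight is the integrating
  -- factor `exp (-∫ g)`.
  set g : ℝ → ℝ := fun x => sinc (θ₂ x - θ₁ x) *
    (P₁ x * cos (θ₁ x + θ₂ x) + (Q₁ x - κ) * sin (θ₁ x + θ₂ x)) with hg
  have hgi : IntervalIntegrable g volume 0 T := by
    refine IntervalIntegrable.continuousOn_mul ?_ (continuous_sinc.comp_continuousOn (c₂.sub c₁))
    refine (((intervalIntegrable_of_measurable_of_bounded hP₁m hP₁ 0 T).mul_continuousOn ?_).add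
      (((intervalIntegrable_of_measurable_of_bounded hQ₁m hQ₁ 0 T).sub
        intervalIntegrable_const).mul_continuousOn ?_))
    · exact continuous_cos.comp_continuousOn (c₁.add c₂)
    · exact continuous_sin.comp_continuousOn (c₁.add c₂)
  have hgb (x : ℝ) : |g x| ≤ |κ| + 2 * M := by
    rw [hg, abs_mul]
    exact (mul_le_of_le_one_left (abs_nonneg _) (abs_sinc_le_one _)).trans
      (abs_pruferSlope_le x _ (hP₁ x) (hQ₁ x))
  have hIb : ∀ x ∈ Icc 0 T, |∫ t in (0 : ℝ)..x, g t| ≤ (|κ| + 2 * M) * T := by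
    intro x hx
    refine (intervalIntegral.norm_integral_le_of_norm_le_const (f := g) (C := |κ| + 2 * M)
      fun t _ => hgb t).trans ?_
    rw [sub_zero, abs_of_nonneg hx.1]
    gcongr
    exact hx.2
  refine ⟨fun x => exp (-∫ t in (0 : ℝ)..x, g t), ?_, fun x hx => ⟨?_, ?_⟩, ?_⟩
  · exact ((HasACDeriv.of_integral hgi).continuousOn hT).neg.rexp
  · exact exp_le_exp.2 (neg_le_neg (abs_le.1 (hIb x hx)).2)
  · exact exp_le_exp.2 (by linarith [(abs_le.1 (hIb x hx)).1])
  · refine HasACDeriv.exp_mul_eq (f := fun x => θ₂ x - θ₁ x) hgi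
      ((h₂.sub h₁).congr_deriv' fun x => ?_)
    have h3 : sinc (θ₂ x - θ₁ x) * (θ₂ x - θ₁ x) = sin (θ₂ x - θ₁ x) := by
      by_cases h : θ₂ x - θ₁ x = 0
      · simp [h]
      · rw [sinc_of_ne_zero h, div_mul_cancel₀ _ h]
    have h4 := pruferField_sub κ P₁ Q₁ x (θ₁ x) (θ₂ x)
    rw [← h3] at h4
    simp only [hg]
    simp only [pruferField] at h4 ⊢
    linear_combination h4

end Comparison

/-- Splits off the nominal speed `κ`: the rest is small when `P` and `Q - κ` are, and vanishes
wherever `sin θ = 0`. -/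
theorem pruferField_eq_add (κ : ℝ) (P Q : ℝ → ℝ) (x θ : ℝ) :
    pruferField κ P Q x θ = κ + (P x * (sin θ * cos θ) + (Q x - κ) * sin θ ^ 2) := by
  rw [pruferField]
  linear_combination κ * sin_sq_add_cos_sq θ

/-! ### Monotonicity, a priori bounds and first order expansion of the angle -/

namespace IsPruferAngle

variable {T κ M : ℝ} {P Q P₁ Q₁ P₂ Q₂ θ θ₁ θ₂ : ℝ → ℝ}

/-- The Prüfer angle depends on the coefficients in a Lipschitz way. -/
theorem abs_sub_le {d : ℝ} (hT : 0 ≤ T) (hP₁m : Measurable P₁) (hQ₁m : Measurable Q₁)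
    (hP₁ : ∀ x, |P₁ x| ≤ M) (hQ₁ : ∀ x, |Q₁ x| ≤ M)
    (h₁ : IsPruferAngle T κ P₁ Q₁ θ₁) (h₂ : IsPruferAngle T κ P₂ Q₂ θ₂)
    (hP : ∀ x, |P₂ x - P₁ x| ≤ d) (hQ : ∀ x, |Q₂ x - Q₁ x| ≤ d) :
    |θ₂ T - θ₁ T| ≤ exp ((|κ| + 2 * M) * T) * (exp ((|κ| + 2 * M) * T) * (d + d) * T) := by
  obtain ⟨E, -, hE, hEq⟩ := exists_weight_mul_sub_eq hT hP₁m hQ₁m hP₁ hQ₁ h₁.hasACDeriv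
    h₂.hasACDeriv
  rw [h₁.zero, h₂.zero, sub_zero, zero_add] at hEq
  set B := (|κ| + 2 * M) * T with hB
  have h3 : |E T * (θ₂ T - θ₁ T)| ≤ exp B * (d + d) * T := by
    rw [hEq, ← Real.norm_eq_abs]
    refine (intervalIntegral.norm_integral_le_of_norm_le_const (C := exp B * (d + d))
      fun x hx => ?_).trans_eq (by rw [sub_zero, abs_of_nonneg hT])
    rw [uIoc_of_le hT] at hx
    have hE' := hE x (Ioc_subset_Icc_self hx)
    rw [Real.norm_eq_abs, abs_mul, abs_of_pos ((exp_pos _).trans_le hE'.1)]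
    gcongr
    · exact hE'.2
    · refine (abs_add_le _ _).trans (add_le_add ?_ ?_)
      · rw [abs_mul, abs_mul]
        exact (mul_le_of_le_one_right (abs_nonneg _) (mul_le_one₀ (abs_sin_le_one _)
          (abs_nonneg _) (abs_cos_le_one _))).trans (hP x)
      · rw [abs_mul, abs_of_nonneg (sq_nonneg (sin _))]
        exact (mul_le_of_le_one_right (abs_nonneg _) (sin_sq_le_one _)).trans (hQ x)
  have hET := (hE T ⟨hT, le_rfl⟩).1
  rw [abs_mul, abs_of_pos ((exp_pos _).trans_le hET)] at h3
  calc |θ₂ T - θ₁ T| = exp B * (exp (-B) * |θ₂ T - θ₁ T|) := by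
        rw [← mul_assoc, ← exp_add]; simp
    _ ≤ exp B * (E T * |θ₂ T - θ₁ T|) := by gcongr
    _ ≤ _ := by gcongr

/-- The Prüfer angle is not locked at the zeros of the sine. -/
theorem exists_sin_ne_zero (hT : 0 < T) (hκ : 0 < κ) (h : IsPruferAngle T κ P Q θ) :
    ∃ x ∈ Icc 0 T, sin (θ x) ≠ 0 := by
  by_contra! hsin
  -- As long as `sin θ = 0` the angle moves at speed `κ`, so `θ S = κ S`; the cutoff `1 / κ` puts
  -- this in `(0, 1]`, where the sine is positive.
  set S := min T (1 / κ) with hS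
  have hS0 : 0 < S := lt_min hT (by positivity)
  have hST : S ∈ Icc 0 T := ⟨hS0.le, min_le_left _ _⟩
  have h1 := (h.hasACDeriv.mono (x := S) (by rwa [uIcc_of_le hT.le])).integral_eq_sub
  have h2 : ∫ t in (0 : ℝ)..S, pruferField κ P Q t (θ t) = ∫ t in (0 : ℝ)..S, κ := by
    refine intervalIntegral.integral_congr fun t ht => ?_
    rw [uIcc_of_le hS0.le] at ht
    have := hsin t ⟨ht.1, ht.2.trans hST.2⟩
    simp only [pruferField_eq_add, this]
    ring
  rw [h2, h.zero, intervalIntegral.integral_const, smul_eq_mul, sub_zero, sub_zero] at h1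
  have h3 : S * κ ≤ 1 := by
    have := min_le_right T (1 / κ)
    rw [← hS, le_div_iff₀ hκ] at this
    exact this
  have h4 : 0 < sin (S * κ) :=
    sin_pos_of_pos_of_lt_pi (by positivity) (by linarith [Real.pi_gt_three])
  rw [h1] at h4
  exact h4.ne' (hsin S hST)

/-- The Prüfer angle is strictly increasing in the potential. -/
theorem lt_of_lt {c : ℝ} (hT : 0 < T) (hκ : 0 < κ) (hPm : Measurable P) (hQ₁m : Measurable Q₁)
    (hQ₂m : Measurable Q₂) (hP : ∀ x, |P x| ≤ M) (hQ₁ : ∀ x, |Q₁ x| ≤ M) (hQ₂ : ∀ x, |Q₂ x| ≤ M)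
    (h₁ : IsPruferAngle T κ P Q₁ θ₁) (h₂ : IsPruferAngle T κ P Q₂ θ₂) (hc : 0 < c)
    (hQ : ∀ x, c ≤ Q₂ x - Q₁ x) : θ₁ T < θ₂ T := by
  obtain ⟨E, hEc, hE, hEq⟩ := exists_weight_mul_sub_eq hT.le hPm hQ₁m hP hQ₁ h₁.hasACDeriv
    h₂.hasACDeriv
  rw [h₁.zero, h₂.zero, sub_zero, zero_add] at hEq
  set B := (|κ| + 2 * M) * T with hB
  have c₂ : ContinuousOn (fun x => sin (θ₂ x) ^ 2) (Icc 0 T) :=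
    (continuous_sin.comp_continuousOn (h₂.hasACDeriv.continuousOn hT.le)).pow 2
  -- Only the term `(Q₂ - Q₁) sin² θ₂` drives the difference; it is nonnegative, and positive
  -- somewhere because the angle is not locked at zeros of the sine.
  have hpos : 0 < ∫ x in (0 : ℝ)..T, exp (-B) * (c * sin (θ₂ x) ^ 2) := by
    refine intervalIntegral.integral_pos hT (continuousOn_const.mul (continuousOn_const.mul c₂))
      (fun x _ => by positivity) ?_
    obtain ⟨x, hx, hx'⟩ := h₂.exists_sin_ne_zero hT hκ
    exact ⟨x, hx, by positivity⟩
  have hle : ∫ x in (0 : ℝ)..T, exp (-B) * (c * sin (θ₂ x) ^ 2) ≤ ∫ x in (0 : ℝ)..T,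
        E x * ((P x - P x) * (sin (θ₂ x) * cos (θ₂ x)) + (Q₂ x - Q₁ x) * sin (θ₂ x) ^ 2) := by
    refine intervalIntegral.integral_mono_on hT.le ?_ ?_ fun x hx => ?_
    · refine ContinuousOn.intervalIntegrable ?_
      rw [uIcc_of_le hT.le]
      exact continuousOn_const.mul (continuousOn_const.mul c₂)
    · simp only [sub_self, zero_mul, zero_add]
      refine IntervalIntegrable.continuousOn_mul (IntervalIntegrable.mul_continuousOn ?_
        (by rwa [uIcc_of_le hT.le])) (by rwa [uIcc_of_le hT.le])
      exact (intervalIntegrable_of_measurable_of_bounded hQ₂m hQ₂ 0 T).sub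
        (intervalIntegrable_of_measurable_of_bounded hQ₁m hQ₁ 0 T)
    · simp only [sub_self, zero_mul, zero_add]
      have := hQ x
      gcongr
      · exact (exp_pos _).le.trans (hE x hx).1
      · exact (hE x hx).1
  rw [← hEq] at hle
  have := pos_of_mul_pos_right (hpos.trans_le hle) ((exp_pos _).le.trans (hE T ⟨hT.le, le_rfl⟩).1)
  linarith

/-- Without potential the Prüfer angle does not reach `π / 2`. -/
theorem lt_pi_div_two (hT : 0 ≤ T) (hPm : Measurable P) (hP : ∀ x, |P x| ≤ M)
    (h : IsPruferAngle T κ P 0 θ) : θ T < π / 2 := by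
  have hM : 0 ≤ M := (abs_nonneg _).trans (hP 0)
  -- Without potential the constant `π / 2` is itself a solution, since every remaining term
  -- contains `cos θ`. It acts as a barrier.
  have h2 : HasACDeriv T (fun _ => π / 2) fun x => pruferField κ P 0 x (π / 2) :=
    (HasACDeriv.of_const (π / 2)).congr_deriv' fun x => by simp [pruferField]
  obtain ⟨E, -, hE, hEq⟩ := exists_weight_mul_sub_eq (M := M) hT hPm measurable_zero hP
    (fun _ => by simpa using hM) h.hasACDeriv h2
  simp only [Pi.zero_apply, h.zero, sub_self, zero_mul, mul_zero,
    intervalIntegral.integral_zero, sub_zero, add_zero] at hEq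
  have hE0 := (exp_pos _).trans_le (hE T ⟨hT, le_rfl⟩).1
  have h3 : 0 < E T * (π / 2 - θ T) := by rw [hEq]; positivity
  have := pos_of_mul_pos_right h3 hE0.le
  linarith

/-- The function is the continuous lift of `arctan (2 tan θ)`, that is, the Prüfer angle after
rescaling one axis by `2`. It fixes the zeros of the sine and straightens the flow `θ' = (κ / 2)
(cos² θ + 4 sin² θ)` to constant speed `κ`. -/
theorem hasDerivAt_add_arctan (θ : ℝ) :
    HasDerivAt (fun y => y + arctan (sin y * cos y / (1 + sin y ^ 2)))
      (2 / (cos θ ^ 2 + 4 * sin θ ^ 2)) θ := by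
  have h1 : (1 : ℝ) + sin θ ^ 2 ≠ 0 := by positivity
  have h2 := (((hasDerivAt_sin θ).mul (hasDerivAt_cos θ)).div
    (((hasDerivAt_sin θ).pow 2).const_add 1) h1).arctan
  refine ((hasDerivAt_id θ).add h2).congr_deriv ?_
  have hc : cos θ ^ 2 = 1 - sin θ ^ 2 := by linarith [sin_sq_add_cos_sq θ]
  have h3 : (1 : ℝ) + 3 * sin θ ^ 2 ≠ 0 := by positivity
  have h4 : cos θ ^ 2 + 4 * sin θ ^ 2 = 1 + 3 * sin θ ^ 2 := by rw [hc]; ring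
  have h5 : (1 : ℝ) + ((sin θ * cos θ) / (1 + sin θ ^ 2)) ^ 2 =
      (1 + 3 * sin θ ^ 2) / (1 + sin θ ^ 2) ^ 2 := by
    field_simp
    linear_combination sin θ ^ 2 * hc
  have h6 : (cos θ * cos θ + sin θ * -sin θ) * (1 + sin θ ^ 2)
      - sin θ * cos θ * (2 * sin θ ^ (2 - 1) * cos θ) = 1 - 3 * sin θ ^ 2 := by
    simp only [Nat.add_one_sub_one, pow_one]
    linear_combination (1 - sin θ ^ 2) * hc
  simp only [Pi.mul_apply, Pi.div_apply, Pi.pow_apply, Nat.cast_ofNat]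
  rw [h4, h5, h6]
  field_simp
  ring

/-- A large potential turns the Prüfer angle at least once per half period of `sin (κ x)`. -/
theorem le_of_large (hT : 0 ≤ T) (hκ : 0 < κ) (h : IsPruferAngle T κ P Q θ)
    (hQ : ∀ x, 2 * κ ≤ Q x - P x ^ 2 / (2 * κ)) (hsin : sin (κ * T) = 0) : κ * T ≤ θ T := by
  set F : ℝ → ℝ := fun y => y + arctan (sin y * cos y / (1 + sin y ^ 2)) with hF
  have hden (y : ℝ) : 0 < cos y ^ 2 + 4 * sin y ^ 2 := by
    nlinarith [sin_sq_add_cos_sq y, sq_nonneg (sin y)]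
  have hmono : StrictMono F := strictMono_of_hasDerivAt_pos hasDerivAt_add_arctan
    fun y => by have := hden y; positivity
  have hFc : ContDiff ℝ 1 F := by
    refine contDiff_id.add (ContDiff.arctan ?_)
    refine (contDiff_sin.mul contDiff_cos).div (contDiff_const.add (contDiff_sin.pow 2)) ?_
    intro x
    positivity
  have h1 := h.hasACDeriv.comp hFc hasDerivAt_add_arctan
  have h2 : ∫ t in (0 : ℝ)..T, κ ≤ F (θ T) - F (θ 0) := by
    rw [← h1.integral_eq_sub]
    refine intervalIntegral.integral_mono_on hT intervalIntegrable_const h1.intervalIntegrable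
      fun x _ => ?_
    rw [div_mul_eq_mul_div, le_div_iff₀ (hden _), pruferField]
    -- Completing the square absorbs the mixed term at the cost of half of `κ cos² θ` and of `P² /
    -- (2 κ)` in the potential. What is left is at least `(κ / 2) (cos² θ + 4 sin² θ)`.
    have h3 : 0 ≤ (κ * cos (θ x) + P x * sin (θ x)) ^ 2 / (2 * κ) := by positivity
    have h4 : (κ * cos (θ x) + P x * sin (θ x)) ^ 2 / (2 * κ) =
        κ / 2 * cos (θ x) ^ 2 + P x * (sin (θ x) * cos (θ x))
          + P x ^ 2 / (2 * κ) * sin (θ x) ^ 2 := by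
      field_simp
      ring
    have h5 := mul_le_mul_of_nonneg_right (hQ x) (sq_nonneg (sin (θ x)))
    rw [h4] at h3
    linarith
  rw [h.zero, intervalIntegral.integral_const, smul_eq_mul, sub_zero] at h2
  have h3 : F 0 = 0 := by simp [hF]
  have h4 : F (κ * T) = κ * T := by simp [hF, hsin]
  rw [h3, sub_zero, mul_comm, ← h4] at h2
  exact hmono.le_iff_le.1 h2

/-- First order expansion of the Prüfer angle about the constant coefficient problem. -/
theorem abs_sub_first_order_le {a : ℝ} (hT : 0 ≤ T) (hPm : Measurable P) (hQm : Measurable Q)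
    (hP : ∀ x, |P x| ≤ a) (hQ : ∀ x, |Q x - κ| ≤ a) (h : IsPruferAngle T κ P Q θ) :
    |θ T - κ * T - ∫ x in (0 : ℝ)..T,
      (P x * (sin (κ * x) * cos (κ * x)) + (Q x - κ) * sin (κ * x) ^ 2)|
      ≤ 4 * a ^ 2 * T ^ 2 := by
  have ha : 0 ≤ a := (abs_nonneg _).trans (hP 0)
  -- `G` has both size and Lipschitz constant in the angle at most `2 a`. The size keeps `θ` within
  -- `2 a T` of `κ x`, and the Lipschitz constant then makes the error of inserting `κ x` for `θ`
  -- quadratic in `a`.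
  set G : ℝ → ℝ → ℝ := fun x y => P x * (sin y * cos y) + (Q x - κ) * sin y ^ 2 with hG
  have hGb (x y : ℝ) : |G x y| ≤ 2 * a := by
    refine (abs_add_le _ _).trans ((add_le_add ?_ ?_).trans_eq (two_mul a).symm)
    · rw [abs_mul, abs_mul]
      exact (mul_le_of_le_one_right (abs_nonneg _) (mul_le_one₀ (abs_sin_le_one _)
        (abs_nonneg _) (abs_cos_le_one _))).trans (hP x)
    · rw [abs_mul, abs_of_nonneg (sq_nonneg (sin _))]
      exact (mul_le_of_le_one_right (abs_nonneg _) (sin_sq_le_one _)).trans (hQ x)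
  have hGl (x y z : ℝ) : |G x y - G x z| ≤ 2 * a * |y - z| := by
    have h1 : G x y - G x z = sin (y - z) * (P x * cos (z + y) + (Q x - κ) * sin (z + y)) := by
      rw [← pruferField_sub, pruferField_eq_add, pruferField_eq_add]
      ring
    rw [h1, abs_mul, mul_comm]
    refine mul_le_mul ((abs_add_le _ _).trans ((add_le_add ?_ ?_).trans_eq (two_mul a).symm))
      abs_sin_le_abs (abs_nonneg _) (by positivity)
    · rw [abs_mul]
      exact (mul_le_of_le_one_right (abs_nonneg _) (abs_cos_le_one _)).trans (hP x)
    · rw [abs_mul]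
      exact (mul_le_of_le_one_right (abs_nonneg _) (abs_sin_le_one _)).trans (hQ x)
  have hlin : HasACDeriv T (fun x => κ * x) (fun _ => κ) :=
    HasACDeriv.of_contDiff (contDiff_const.mul contDiff_id)
      fun y => by simpa using (hasDerivAt_id y).const_mul κ
  have hφ : HasACDeriv T (fun x => θ x - κ * x) (fun x => G x (θ x)) :=
    (h.hasACDeriv.sub hlin).congr_deriv' fun x => by rw [pruferField_eq_add]; ring
  have hsmall : ∀ x ∈ Icc 0 T, |θ x - κ * x| ≤ 2 * a * T := by
    intro x hx
    have h1 := (hφ.mono (x := x) (by rwa [uIcc_of_le hT])).integral_eq_sub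
    rw [h.zero, mul_zero, sub_zero, sub_zero] at h1
    rw [← h1]
    refine (intervalIntegral.norm_integral_le_of_norm_le_const (f := fun x => G x (θ x))
      (C := 2 * a) fun t _ => hGb t _).trans ?_
    rw [sub_zero, abs_of_nonneg hx.1]
    gcongr
    exact hx.2
  have hint : IntervalIntegrable (fun x => G x (κ * x)) volume 0 T :=
    intervalIntegrable_of_measurable_of_bounded (by simp only [hG]; fun_prop)
      (fun x => hGb x _) 0 T
  have h1 := hφ.integral_eq_sub
  rw [h.zero, mul_zero, sub_zero, sub_zero] at h1
  rw [← h1, ← intervalIntegral.integral_sub hφ.intervalIntegrable hint]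
  rw [← Real.norm_eq_abs]
  refine (intervalIntegral.norm_integral_le_of_norm_le_const (C := 2 * a * (2 * a * T))
    fun x hx => ?_).trans_eq (by rw [sub_zero, abs_of_nonneg hT]; ring)
  rw [uIoc_of_le hT] at hx
  refine (hGl x _ _).trans ?_
  gcongr
  exact hsmall x (Ioc_subset_Icc_self hx)

end IsPruferAngle

/-! ### Prüfer angles, Dirichlet solutions and reality of the spectrum -/

section RealSolutions

variable {T κ M : ℝ} {P Q θ : ℝ → ℝ}

/-- One four-parameter family covers the growth rates of `Z`, `R` and `r` in the two
polar-coordinate arguments that follow. -/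
theorem intervalIntegrable_amplitudeRate (hT : 0 ≤ T) (hPm : Measurable P)
    (hQm : Measurable Q) (hP : ∀ x, |P x| ≤ M) (hQ : ∀ x, |Q x| ≤ M)
    (hθ : ContinuousOn θ (Icc 0 T)) (a b c d : ℝ) :
    IntervalIntegrable (fun x => a * (sin (θ x) * cos (θ x)) + b * (P x * cos (θ x) ^ 2) +
      c * (P x * sin (θ x) ^ 2) + d * (Q x * (sin (θ x) * cos (θ x)))) volume 0 T := by
  have hs : ContinuousOn (fun x => sin (θ x)) (uIcc 0 T) := by
    rw [uIcc_of_le hT]; exact continuous_sin.comp_continuousOn hθ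
  have hc : ContinuousOn (fun x => cos (θ x)) (uIcc 0 T) := by
    rw [uIcc_of_le hT]; exact continuous_cos.comp_continuousOn hθ
  have hPi := intervalIntegrable_of_measurable_of_bounded hPm hP 0 T
  have hQi := intervalIntegrable_of_measurable_of_bounded hQm hQ 0 T
  exact ((((hs.mul hc).intervalIntegrable.const_mul a).add
    ((hPi.mul_continuousOn (hc.pow 2)).const_mul b)).add
    ((hPi.mul_continuousOn (hs.pow 2)).const_mul c)).add
    ((hQi.mul_continuousOn (hs.mul hc)).const_mul d)

/-- A nontrivial solution of the Dirichlet problem forces the Prüfer angle to end at a multiple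
of `π`. -/
theorem IsPruferAngle.sin_eq_zero (hT : 0 ≤ T) (hκ : 0 < κ) (hPm : Measurable P)
    (hQm : Measurable Q) (hP : ∀ x, |P x| ≤ M) (hQ : ∀ x, |Q x| ≤ M)
    (h : IsPruferAngle T κ P Q θ) {u u₁ : ℝ → ℝ} (hu : HasACDeriv T u u₁)
    (hu₁ : HasACDeriv T u₁ fun x => -P x * u₁ x - κ * Q x * u x)
    (h0 : u 0 = 0) (h1 : u T = 0) (hne : ∃ x ∈ Icc 0 T, u x ≠ 0) : sin (θ T) = 0 := by
  have hsinD : HasACDeriv T (fun x => sin (θ x)) _ := h.hasACDeriv.comp contDiff_sin hasDerivAt_sin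
  have hcosD : HasACDeriv T (fun x => cos (θ x)) _ := h.hasACDeriv.comp contDiff_cos hasDerivAt_cos
  have hθc := h.hasACDeriv.continuousOn hT
  -- `(R, Z)` is `(u, u₁ / κ)` in the frame rotating with `θ`, up to a factor `κ` in `Z`. The
  -- component `Z` obeys a homogeneous linear equation and starts at `0`, so the solution stays
  -- aligned with the frame and `u = R sin θ`.
  set Z : ℝ → ℝ := fun x => κ * (u x * cos (θ x)) - u₁ x * sin (θ x) with hZ
  set R : ℝ → ℝ := fun x => u x * sin (θ x) + κ⁻¹ * (u₁ x * cos (θ x)) with hR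
  have hid (x : ℝ) : u x = R x * sin (θ x) + κ⁻¹ * (Z x * cos (θ x)) := by
    simp only [hR, hZ]
    field_simp
    linear_combination -u x * κ * sin_sq_add_cos_sq (θ x)
  have hid₁ (x : ℝ) : u₁ x = κ * (R x * cos (θ x)) - Z x * sin (θ x) := by
    simp only [hR, hZ]
    field_simp
    linear_combination -u₁ x * sin_sq_add_cos_sq (θ x)
  have hZD : HasACDeriv T Z fun x => ((-κ) * (sin (θ x) * cos (θ x)) + 0 * (P x * cos (θ x) ^ 2) +
      (-1) * (P x * sin (θ x) ^ 2) + 1 * (Q x * (sin (θ x) * cos (θ x)))) * Z x := by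
    refine (((hu.mul hcosD).const_mul κ).sub (hu₁.mul hsinD)).congr_deriv' fun x => ?_
    simp only [hZ, pruferField]
    have hc : cos (θ x) ^ 2 = 1 - sin (θ x) ^ 2 := by linarith [sin_sq_add_cos_sq (θ x)]
    have hc3 : cos (θ x) ^ 3 = (1 - sin (θ x) ^ 2) * cos (θ x) := by rw [← hc]; ring
    ring_nf
    simp only [hc, hc3]
    ring
  have hZ0 : ∀ x ∈ Icc 0 T, Z x = 0 := by
    intro x hx
    rw [hZD.eq_mul_exp hT
      (intervalIntegrable_amplitudeRate hT hPm hQm hP hQ hθc _ _ _ _) hx]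
    simp [hZ, h0, h.zero]
  -- This equation closes in `R` alone only because `Z` is already known to vanish.
  have hRD : HasACDeriv T R fun x => (κ * (sin (θ x) * cos (θ x)) + (-1) * (P x * cos (θ x) ^ 2) +
      0 * (P x * sin (θ x) ^ 2) + (-1) * (Q x * (sin (θ x) * cos (θ x)))) * R x := by
    refine ((hu.mul hsinD).add ((hu₁.mul hcosD).const_mul κ⁻¹)).congr_deriv
      (Filter.Eventually.of_forall fun x hx => ?_)
    rw [uIcc_of_le hT] at hx
    have hux := hid x
    have hux₁ := hid₁ x
    rw [hZ0 x hx] at hux hux₁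
    rw [hux, hux₁]
    field_simp
    ring
  -- If `sin (θ T) ≠ 0`, then `u T = 0` and `Z T = 0` force `u₁ T = 0`; so `R` vanishes at `T`,
  -- hence everywhere, contradicting `u ≠ 0`.
  have hRT (hs : sin (θ T) ≠ 0) : R T = 0 := by
    have h2 := hZ0 T ⟨hT, le_rfl⟩
    simp only [hZ, h1, zero_mul, mul_zero, zero_sub, neg_eq_zero] at h2
    simp [hR, h1, (mul_eq_zero.1 h2).resolve_right hs]
  by_contra hs
  have hRx := fun x hx => hRD.eq_mul_exp hT (x := x)
    (intervalIntegrable_amplitudeRate hT hPm hQm hP hQ hθc _ _ _ _) hx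
  have hR0 : R 0 = 0 := by
    have h2 := hRx T ⟨hT, le_rfl⟩
    rw [hRT hs] at h2
    exact (mul_eq_zero.1 h2.symm).resolve_right (exp_pos _).ne'
  obtain ⟨x, hx, hux⟩ := hne
  refine hux ?_
  rw [hid x, hZ0 x hx, hRx x hx, hR0]
  simp

/-- The solution of the initial value problem in polar form. -/
theorem IsPruferAngle.exists_solution (hT : 0 < T) (hκ : 0 < κ) (hPm : Measurable P)
    (hQm : Measurable Q) (hP : ∀ x, |P x| ≤ M) (hQ : ∀ x, |Q x| ≤ M)
    (h : IsPruferAngle T κ P Q θ) (hsin : sin (θ T) = 0) :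
    ∃ u u₁ : ℝ → ℝ, HasACDeriv T u u₁ ∧
      (HasACDeriv T u₁ fun x => -P x * u₁ x - κ * Q x * u x) ∧ u 0 = 0 ∧ u T = 0 ∧
      ∃ x ∈ Icc 0 T, u x ≠ 0 := by
  have hsinD : HasACDeriv T (fun x => sin (θ x)) _ := h.hasACDeriv.comp contDiff_sin hasDerivAt_sin
  have hcosD : HasACDeriv T (fun x => cos (θ x)) _ := h.hasACDeriv.comp contDiff_cos hasDerivAt_cos
  have hθc := h.hasACDeriv.continuousOn hT.le
  have hrD := (HasACDeriv.of_integral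
    (intervalIntegrable_amplitudeRate hT.le hPm hQm hP hQ hθc κ (-1) 0 (-1))).comp
    contDiff_exp hasDerivAt_exp
  set r : ℝ → ℝ := fun x => exp (∫ x in (0 : ℝ)..x, (κ * (sin (θ x) * cos (θ x)) +
    (-1) * (P x * cos (θ x) ^ 2) + 0 * (P x * sin (θ x) ^ 2) +
    (-1) * (Q x * (sin (θ x) * cos (θ x))))) with hr
  refine ⟨fun x => r x * sin (θ x), fun x => κ * (r x * cos (θ x)),
    (hrD.mul hsinD).congr_deriv' fun x => ?_,
    ((hrD.mul hcosD).const_mul κ).congr_deriv' fun x => ?_, ?_, ?_, ?_⟩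
  · simp only [pruferField]
    linear_combination (κ * r x * cos (θ x)) * sin_sq_add_cos_sq (θ x)
  · simp only [pruferField]
    linear_combination (-κ * r x * P x * cos (θ x) - κ * r x * Q x * sin (θ x)) *
      sin_sq_add_cos_sq (θ x)
  · simp [h.zero]
  · simp [hsin]
  · obtain ⟨x, hx, hx'⟩ := h.exists_sin_ne_zero hT hκ
    exact ⟨x, hx, mul_ne_zero (exp_pos _).ne' hx'⟩

/-- The spectral parameter of a nontrivial solution of the Dirichlet problem is real: a complex
solution `u + i v` with spectral parameter `α + i β` has `β = 0`. -/
theorem im_spectralParameter_eq_zero {c α β : ℝ} {w u v u₁ v₁ : ℝ → ℝ} (hT : 0 < T)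
    (hPm : Measurable P) (hwm : Measurable w) (hP : ∀ x, |P x| ≤ M) (hw : ∀ x, |w x| ≤ M)
    (hc : 0 < c) (hcw : ∀ x, c ≤ w x)
    (hu : HasACDeriv T u u₁) (hv : HasACDeriv T v v₁)
    (hu₁ : HasACDeriv T u₁ fun x => -P x * u₁ x - w x * (α * u x - β * v x))
    (hv₁ : HasACDeriv T v₁ fun x => -P x * v₁ x - w x * (α * v x + β * u x))
    (hu0 : u 0 = 0) (hv0 : v 0 = 0) (huT : u T = 0) (hvT : v T = 0)
    (hne : ∃ x ∈ Icc 0 T, u x ^ 2 + v x ^ 2 ≠ 0) : β = 0 := by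
  have hpD := (HasACDeriv.of_integral
    (intervalIntegrable_of_measurable_of_bounded hPm hP 0 T)).comp contDiff_exp hasDerivAt_exp
  set p : ℝ → ℝ := fun x => exp (∫ t in (0 : ℝ)..x, P t) with hp
  -- The Wronskian of real and imaginary part, times the integrating factor of the damping: the
  -- terms with `P` and `α` cancel, and only a definite multiple of `β` remains to be integrated.
  have hW := (hpD.mul ((hv₁.mul hu).sub (hu₁.mul hv))).congr_deriv'
    (g' := fun x => -β * (w x * (p x * (u x ^ 2 + v x ^ 2)))) fun x => by ring
  have h1 := hW.integral_eq_sub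
  rw [intervalIntegral.integral_const_mul] at h1
  simp only [hu0, hv0, huT, hvT, mul_zero, sub_self] at h1
  have hcont : ContinuousOn (fun x => p x * (u x ^ 2 + v x ^ 2)) (Icc 0 T) :=
    (hpD.continuousOn hT.le).mul
      (((hu.continuousOn hT.le).pow 2).add ((hv.continuousOn hT.le).pow 2))
  have hpos : 0 < ∫ x in (0 : ℝ)..T, c * (p x * (u x ^ 2 + v x ^ 2)) := by
    refine intervalIntegral.integral_pos hT (continuousOn_const.mul hcont)
      (fun x _ => by positivity) ?_
    obtain ⟨x, hx, hx'⟩ := hne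
    have hx'' : 0 < u x ^ 2 + v x ^ 2 := lt_of_le_of_ne (by positivity) hx'.symm
    exact ⟨x, hx, by positivity⟩
  have hle : ∫ x in (0 : ℝ)..T, c * (p x * (u x ^ 2 + v x ^ 2)) ≤
      ∫ x in (0 : ℝ)..T, w x * (p x * (u x ^ 2 + v x ^ 2)) := by
    refine intervalIntegral.integral_mono_on hT.le ?_ ?_ fun x _ => ?_
    · exact ContinuousOn.intervalIntegrable (by
        rw [uIcc_of_le hT.le]; exact continuousOn_const.mul hcont)
    · exact (intervalIntegrable_of_measurable_of_bounded hwm hw 0 T).mul_continuousOn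
        (by rwa [uIcc_of_le hT.le])
    · have := hcw x
      gcongr
  have := (mul_eq_zero.1 h1).resolve_right (hpos.trans_le hle).ne'
  linarith

end RealSolutions

/-! ### Reduction of the eigenvalue problem to the Prüfer angle -/

section Eigenvalue

/-- The stiffness `k₀ + ε k_s / 2` of the mistuned platoon. -/
noncomputable def stiffness (k₀ ε : ℝ) (ks : ℝ → ℝ) (x : ℝ) : ℝ := k₀ + ε * ks x / 2

/-- The coefficient of `η'` in the normalized equation; `ρ` is the mean density. -/
noncomputable def pruferDamping (k₀ ρ ε : ℝ) (km ks : ℝ → ℝ) (x : ℝ) : ℝ :=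
  ε * ρ * km x / stiffness k₀ ε ks x

/-- The potential of the Prüfer equation for the spectral parameter `lam`. -/
noncomputable def pruferPotential (k₀ κ ε lam : ℝ) (ks : ℝ → ℝ) (x : ℝ) : ℝ :=
  lam / (κ * stiffness k₀ ε ks x)

variable {k₀ b₀ κ ε lam M c : ℝ} {km ks : ℝ → ℝ} {N : ℕ} {s : ℂ}

theorem IsDirichletEigenvalue.congr {km' ks' : ℝ → ℝ}
    (hkm : km =ᵐ[volume.restrict (Icc 0 (2 * π))] km')
    (hks : ks =ᵐ[volume.restrict (Icc 0 (2 * π))] ks')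
    (h : IsDirichletEigenvalue b₀ k₀ km ks N ε s) : IsDirichletEigenvalue b₀ k₀ km' ks' N ε s := by
  obtain ⟨η, η₁, η₂, h1, h2, h3, h4, h5⟩ := h
  refine ⟨η, η₁, η₂, h1, h2, h3, h4, ?_⟩
  filter_upwards [hkm, hks, h5] with x e1 e2 e3
  rw [e3, e1, e2]

/-- Integrability of `η₁` is not part of the structure. It follows because `η₂ ∈ L² ⊆ L¹` makes `η₁`
continuous, so `η₁` has to be treated before `η`. -/
theorem IsSobolevH2.hasACDeriv {η η₁ η₂ : ℝ → ℂ} (h : IsSobolevH2 η η₁ η₂) :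
    HasACDeriv (2 * π) (fun x => (η x).re) (fun x => (η₁ x).re) ∧
    HasACDeriv (2 * π) (fun x => (η x).im) (fun x => (η₁ x).im) ∧
    HasACDeriv (2 * π) (fun x => (η₁ x).re) (fun x => (η₂ x).re) ∧
    HasACDeriv (2 * π) (fun x => (η₁ x).im) (fun x => (η₂ x).im) := by
  have hT : (0 : ℝ) ≤ 2 * π := by positivity
  have key : ∀ f g : ℝ → ℂ, IntervalIntegrable g volume 0 (2 * π) →
      (∀ x ∈ Icc 0 (2 * π), f x = f 0 + ∫ t in (0 : ℝ)..x, g t) →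
      HasACDeriv (2 * π) (fun x => (f x).re) (fun x => (g x).re) ∧
      HasACDeriv (2 * π) (fun x => (f x).im) (fun x => (g x).im) := by
    intro f g hg hfg
    have hsub : ∀ x ∈ Icc 0 (2 * π), IntervalIntegrable g volume 0 x := fun x hx =>
      hg.mono_set (uIcc_subset_uIcc left_mem_uIcc (by rwa [uIcc_of_le hT]))
    refine ⟨.of_eq_integral hT ⟨hg.1.re, hg.2.re⟩ fun x hx => ?_,
      .of_eq_integral hT ⟨hg.1.im, hg.2.im⟩ fun x hx => ?_⟩
    · rw [hfg x hx, Complex.add_re]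
      congr 1
      exact (Complex.reCLM.intervalIntegral_comp_comm (hsub x hx)).symm
    · rw [hfg x hx, Complex.add_im]
      congr 1
      exact (Complex.imCLM.intervalIntegral_comp_comm (hsub x hx)).symm
  have h₂ : IntervalIntegrable η₂ volume 0 (2 * π) := by
    rw [intervalIntegrable_iff_integrableOn_Icc_of_le hT]
    exact h.memLp_two.integrable one_le_two
  obtain ⟨a1, a2⟩ := key η₁ η₂ h₂ h.eq_integral'
  have h₁ : IntervalIntegrable η₁ volume 0 (2 * π) := by
    have hc : ContinuousOn (fun x => ((η₁ x).re : ℂ) + (η₁ x).im * Complex.I)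
        (uIcc 0 (2 * π)) :=
      (Complex.continuous_ofReal.comp_continuousOn a1.ac.continuousOn).add
        ((Complex.continuous_ofReal.comp_continuousOn a2.ac.continuousOn).mul continuousOn_const)
    simp only [Complex.re_add_im] at hc
    exact hc.intervalIntegrable
  obtain ⟨a3, a4⟩ := key η η₁ h₁ h.eq_integral
  exact ⟨a3, a4, a1, a2⟩

end Eigenvalue

section Eigenvalue

variable {k₀ b₀ κ ε ρ lam M c C : ℝ} {km ks : ℝ → ℝ} {N : ℕ} {s : ℂ}

theorem measurable_stiffness (hks : Measurable ks) : Measurable (stiffness k₀ ε ks) := by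
  unfold stiffness
  fun_prop

theorem measurable_pruferDamping (hkm : Measurable km) (hks : Measurable ks) :
    Measurable (pruferDamping k₀ ρ ε km ks) :=
  (hkm.const_mul _).div (measurable_stiffness hks)

theorem measurable_pruferPotential (hks : Measurable ks) :
    Measurable (pruferPotential k₀ κ ε lam ks) :=
  measurable_const.div ((measurable_stiffness hks).const_mul κ)

theorem abs_pruferDamping_le {x : ℝ} (hkm : |km x| ≤ M) (hc : 0 < c)
    (hA : c ≤ stiffness k₀ ε ks x) : |pruferDamping k₀ ρ ε km ks x| ≤ |ε * ρ| * M / c := by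
  have hM : 0 ≤ M := (abs_nonneg _).trans hkm
  rw [pruferDamping, abs_div, abs_mul, abs_of_pos (hc.trans_le hA)]
  gcongr

theorem abs_pruferPotential_le {x : ℝ} (hκ : 0 < κ) (hc : 0 < c)
    (hA : c ≤ stiffness k₀ ε ks x) : |pruferPotential k₀ κ ε lam ks x| ≤ |lam| / (κ * c) := by
  rw [pruferPotential, abs_div, abs_of_pos (mul_pos hκ (hc.trans_le hA))]
  gcongr

theorem meanDensity_pos (hN : 0 < N) : 0 < meanDensity N := by
  unfold meanDensity
  positivity

/-- An eigenvalue `s` has a real spectral parameter `-ρ₀² (s² + b₀ s)`, for which the Prüfer angle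
ends at a multiple of `π`. -/
theorem IsDirichletEigenvalue.spectralParameter (hN : 0 < N) (hκ : 0 < κ)
    (hkm : Measurable km) (hks : Measurable ks) (hkmb : ∀ x, |km x| ≤ M) (hc : 0 < c)
    (hA : ∀ x, c ≤ stiffness k₀ ε ks x) (hAC : ∀ x, stiffness k₀ ε ks x ≤ C)
    (h : IsDirichletEigenvalue b₀ k₀ km ks N ε s) :
    ∃ lam : ℝ, (meanDensity N : ℂ) ^ 2 * (s ^ 2 + b₀ * s) = -(lam : ℂ) ∧
      ∀ θ, IsPruferAngle (2 * π) κ (pruferDamping k₀ (meanDensity N) ε km ks)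
        (pruferPotential k₀ κ ε lam ks) θ → sin (θ (2 * π)) = 0 := by
  obtain ⟨η, η₁, η₂, hS, h0, hT, hne, hae⟩ := h
  obtain ⟨hu, hv, hu₁, hv₁⟩ := hS.hasACDeriv
  have hρ := meanDensity_pos hN
  set ρ := meanDensity N with hρdef
  have hTpos : 0 < 2 * π := by positivity
  set z : ℂ := -((ρ : ℂ) ^ 2 * (s ^ 2 + b₀ * s)) with hz
  have hApos (x : ℝ) : 0 < stiffness k₀ ε ks x := hc.trans_le (hA x)
  have hae' : ∀ᵐ x, x ∈ uIcc 0 (2 * π) →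
      (stiffness k₀ ε ks x : ℂ) * η₂ x + ((ε * ρ * km x : ℝ) : ℂ) * η₁ x = -(z * η x) := by
    rw [uIcc_of_le hTpos.le, ← ae_restrict_iff' measurableSet_Icc]
    filter_upwards [hae] with x hx
    have hρ' : (ρ : ℂ) ≠ 0 := Complex.ofReal_ne_zero.2 hρ.ne'
    rw [waveSpeedSq, ← hρdef] at hx
    simp only [stiffness, hz]
    push_cast at hx ⊢
    have h2 : (ρ : ℂ) ^ 2 * (s ^ 2 * η x + b₀ * s * η x) =
        (k₀ + ε * ks x / 2) * η₂ x + ε * ρ * km x * η₁ x := by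
      rw [hx]
      field_simp
      ring
    linear_combination -h2
  have hbP (x : ℝ) : |pruferDamping k₀ ρ ε km ks x| ≤ |ε * ρ| * M / c :=
    abs_pruferDamping_le (hkmb x) hc (hA x)
  set w : ℝ → ℝ := fun x => (stiffness k₀ ε ks x)⁻¹ with hw
  have hre : HasACDeriv (2 * π) (fun x => (η₁ x).re) fun x =>
      -pruferDamping k₀ ρ ε km ks x * (η₁ x).re - w x * (z.re * (η x).re - z.im * (η x).im) := by
    refine hu₁.congr_deriv ?_
    filter_upwards [hae'] with x hx hxT
    have h1 := congrArg Complex.re (hx hxT)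
    simp only [Complex.add_re, Complex.neg_re, Complex.mul_re, Complex.ofReal_re,
      Complex.ofReal_im, zero_mul, sub_zero] at h1
    have := (hApos x).ne'
    simp only [hw, pruferDamping]
    field_simp
    linear_combination h1
  have him : HasACDeriv (2 * π) (fun x => (η₁ x).im) fun x =>
      -pruferDamping k₀ ρ ε km ks x * (η₁ x).im - w x * (z.re * (η x).im + z.im * (η x).re) := by
    refine hv₁.congr_deriv ?_
    filter_upwards [hae'] with x hx hxT
    have h1 := congrArg Complex.im (hx hxT)
    simp only [Complex.add_im, Complex.neg_im, Complex.mul_im, Complex.ofReal_re,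
      Complex.ofReal_im, zero_mul, add_zero] at h1
    have := (hApos x).ne'
    simp only [hw, pruferDamping]
    field_simp
    linear_combination h1
  have hC0 : 0 < C := (hApos 0).trans_le (hAC 0)
  have hwb (x : ℝ) : |w x| ≤ c⁻¹ := by
    rw [hw, abs_of_pos (inv_pos.2 (hApos x))]
    exact inv_anti₀ hc (hA x)
  obtain ⟨x₀, hx₀, hηx₀⟩ := hne
  have hne' : (η x₀).re ≠ 0 ∨ (η x₀).im ≠ 0 := by
    by_contra! hcon
    exact hηx₀ (Complex.ext hcon.1 hcon.2)
  have hPm := measurable_pruferDamping (k₀ := k₀) (ρ := ρ) (ε := ε) hkm hks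
  have hzim : z.im = 0 :=
    -- `1 / (1 + C)` is a positive lower bound for the weight `1 / A`, obtained from the upper bound
    -- `C` for the stiffness.
    im_spectralParameter_eq_zero (M := max (|ε * ρ| * M / c) c⁻¹) (c := 1 / (1 + C)) (w := w)
      hTpos hPm (measurable_stiffness hks).inv (fun x => (hbP x).trans (le_max_left _ _))
      (fun x => (hwb x).trans (le_max_right _ _)) (by positivity) (fun x => by
        have h1 := hApos x
        have h2 := hAC x
        rw [hw, one_div]
        exact inv_anti₀ h1 (by linarith)) hu hv hre him (by simp [h0]) (by simp [h0])
      (by simp [hT]) (by simp [hT]) ⟨x₀, hx₀, fun hcon => by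
        rcases hne' with h | h
        · exact h (by nlinarith [sq_nonneg (η x₀).re, sq_nonneg (η x₀).im])
        · exact h (by nlinarith [sq_nonneg (η x₀).re, sq_nonneg (η x₀).im])⟩
  refine ⟨z.re, ?_, fun θ hθ => ?_⟩
  · rw [← Complex.re_add_im z, hzim] at hz
    simp only [Complex.ofReal_zero, zero_mul, add_zero] at hz
    rw [hz, neg_neg]
  have hQm := measurable_pruferPotential (k₀ := k₀) (κ := κ) (ε := ε) (lam := z.re) hks
  have hbQ (x : ℝ) : |pruferPotential k₀ κ ε z.re ks x| ≤ |z.re| / (κ * c) :=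
    abs_pruferPotential_le hκ hc (hA x)
  -- With a real spectral parameter, real and imaginary part solve the same real problem, and at
  -- least one of them is nonzero at `x₀`.
  have concl : ∀ u u₁ : ℝ → ℝ, HasACDeriv (2 * π) u u₁ → HasACDeriv (2 * π) u₁ (fun x =>
      -pruferDamping k₀ ρ ε km ks x * u₁ x - w x * (z.re * u x)) → u 0 = 0 → u (2 * π) = 0 →
      u x₀ ≠ 0 → sin (θ (2 * π)) = 0 := by
    intro u u₁ hu hu₁ hu0 huT hux
    refine hθ.sin_eq_zero (M := max (|ε * ρ| * M / c) (|z.re| / (κ * c))) hTpos.le hκ hPm hQm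
      (fun x => (hbP x).trans (le_max_left _ _)) (fun x => (hbQ x).trans (le_max_right _ _)) hu
      (hu₁.congr_deriv' fun x => ?_) hu0 huT ⟨x₀, hx₀, hux⟩
    have := (hApos x).ne'
    simp only [hw, pruferPotential]
    field_simp
  rcases hne' with h | h
  · exact concl _ _ hu (by simpa [hzim] using hre) (by simp [h0]) (by simp [hT]) h
  · exact concl _ _ hv (by simpa [hzim] using him) (by simp [h0]) (by simp [hT]) h

/-- If the Prüfer angle for the real spectral parameter `-ρ₀² (s² + b₀ s)` ends at a multiple of
`π`, then `s` is an eigenvalue. -/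
theorem isDirichletEigenvalue_of_sin_eq_zero (hN : 0 < N) (hκ : 0 < κ)
    (hkm : Measurable km) (hks : Measurable ks) (hkmb : ∀ x, |km x| ≤ M) (hc : 0 < c)
    (hA : ∀ x, c ≤ stiffness k₀ ε ks x)
    (hs : (meanDensity N : ℂ) ^ 2 * (s ^ 2 + b₀ * s) = -(lam : ℂ)) {θ : ℝ → ℝ}
    (hθ : IsPruferAngle (2 * π) κ (pruferDamping k₀ (meanDensity N) ε km ks)
        (pruferPotential k₀ κ ε lam ks) θ) (hsin : sin (θ (2 * π)) = 0) :
    IsDirichletEigenvalue b₀ k₀ km ks N ε s := by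
  have hρ := meanDensity_pos hN
  set ρ := meanDensity N with hρdef
  have hTpos : 0 < 2 * π := by positivity
  have hApos (x : ℝ) : 0 < stiffness k₀ ε ks x := hc.trans_le (hA x)
  set P := pruferDamping k₀ ρ ε km ks with hPdef
  set Q := pruferPotential k₀ κ ε lam ks with hQdef
  have hPm : Measurable P := measurable_pruferDamping hkm hks
  have hQm : Measurable Q := measurable_pruferPotential hks
  set B := max (|ε * ρ| * M / c) (|lam| / (κ * c)) with hB
  have hbP (x : ℝ) : |P x| ≤ B :=
    (abs_pruferDamping_le (hkmb x) hc (hA x)).trans (le_max_left _ _)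
  have hbQ (x : ℝ) : |Q x| ≤ B :=
    (abs_pruferPotential_le hκ hc (hA x)).trans (le_max_right _ _)
  obtain ⟨u, u₁, hu, hu₁, hu0, huT, x₀, hx₀, hux₀⟩ :=
    hθ.exists_solution hTpos hκ hPm hQm hbP hbQ hsin
  have hB0 : 0 ≤ B := (abs_nonneg _).trans (hbP 0)
  have hFTC : ∀ {f f' : ℝ → ℝ}, HasACDeriv (2 * π) f f' → ∀ x ∈ Icc 0 (2 * π),
      (f x : ℂ) = f 0 + ∫ t in (0 : ℝ)..x, (f' t : ℂ) := by
    intro f f' hf x hx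
    rw [intervalIntegral.integral_ofReal,
      (hf.mono (x := x) (by rwa [uIcc_of_le hTpos.le])).integral_eq_sub]
    push_cast
    ring
  refine ⟨fun x => u x, fun x => u₁ x, fun x => ((-P x * u₁ x - κ * Q x * u x : ℝ) : ℂ),
    ⟨?_, hFTC hu, hFTC hu₁⟩, by simp [hu0], by simp [huT], ⟨x₀, hx₀, by simpa using hux₀⟩, ?_⟩
  · refine MemLp.ofReal ?_
    obtain ⟨C₁, hC₁⟩ := hu₁.ac.exists_bound
    obtain ⟨C₀, hC₀⟩ := hu.ac.exists_bound
    refine MemLp.of_bound (C := B * C₁ + κ * B * C₀) ?_ ?_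
    · exact (hPm.neg.aestronglyMeasurable.mul
        ((hu₁.continuousOn hTpos.le).aestronglyMeasurable measurableSet_Icc)).sub
        ((hQm.const_mul κ).aestronglyMeasurable.mul
        ((hu.continuousOn hTpos.le).aestronglyMeasurable measurableSet_Icc))
    · rw [ae_restrict_iff' measurableSet_Icc]
      refine Filter.Eventually.of_forall fun x hx => ?_
      rw [← uIcc_of_le hTpos.le] at hx
      refine (norm_sub_le _ _).trans (add_le_add ?_ ?_)
      · rw [norm_mul, norm_neg]
        exact mul_le_mul (hbP x) (hC₁ x hx) (norm_nonneg _) hB0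
      · rw [norm_mul, norm_mul, Real.norm_of_nonneg hκ.le]
        gcongr
        · exact hbQ x
        · exact hC₀ x hx
  · refine Filter.Eventually.of_forall fun x => ?_
    have hA' := (hApos x).ne'
    have hreal : stiffness k₀ ε ks x * (-P x * u₁ x - κ * Q x * u x) + ε * ρ * km x * u₁ x =
        -(lam * u x) := by
      simp only [hPdef, hQdef, pruferDamping, pruferPotential]
      field_simp
      ring
    have hcx := congrArg (fun r : ℝ => (r : ℂ)) hreal
    have hρ' : (ρ : ℂ) ≠ 0 := Complex.ofReal_ne_zero.2 hρ.ne'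
    refine mul_left_cancel₀ (pow_ne_zero 2 hρ') ?_
    rw [waveSpeedSq, ← hρdef]
    simp only [stiffness] at hcx
    push_cast at hcx ⊢
    calc (ρ : ℂ) ^ 2 * (s ^ 2 * u x + b₀ * s * u x)
        = (ρ : ℂ) ^ 2 * (s ^ 2 + b₀ * s) * u x := by ring
      _ = -((lam : ℂ) * u x) := by rw [hs]; ring
      _ = _ := by
        rw [← hcx]
        field_simp
        ring

end Eigenvalue

/-! ### The end angle as a function of `ε` and the spectral parameter -/

/-- Measurable bounded representatives of the mistuning profiles, together with a wave number `κ`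
of a Dirichlet eigenfunction `sin (κ x)` of the nominal problem. -/
structure MistuningData (k₀ κ M : ℝ) (km ks : ℝ → ℝ) : Prop where
  k₀_pos : 0 < k₀
  half_le : 1 / 2 ≤ κ
  sin_eq_zero : sin (κ * (2 * π)) = 0
  bound_pos : 0 < M
  measurable_km : Measurable km
  measurable_ks : Measurable ks
  abs_km_le : ∀ x, |km x| ≤ M
  abs_ks_le : ∀ x, |ks x| ≤ M

/-- The value at `2 π` of the Prüfer angle. -/
noncomputable def endAngle (k₀ κ ρ : ℝ) (km ks : ℝ → ℝ) (ε lam : ℝ) : ℝ :=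
  -- The value is arbitrary when no angle exists; `exists_angle` rules this out for `0 ≤ ε` and `ε *
  -- M ≤ k₀`.
  Classical.epsilon (fun θ => IsPruferAngle (2 * π) κ (pruferDamping k₀ ρ ε km ks)
    (pruferPotential k₀ κ ε lam ks) θ) (2 * π)

namespace MistuningData

variable {k₀ κ M ρ ε ε' lam lam' : ℝ} {km ks : ℝ → ℝ}

theorem κ_pos (H : MistuningData k₀ κ M km ks) : 0 < κ := by linarith [H.half_le]

theorem abs_stiffness_sub_le (H : MistuningData k₀ κ M km ks) (hε : 0 ≤ ε) (x : ℝ) :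
    |stiffness k₀ ε ks x - k₀| ≤ ε * M / 2 := by
  rw [stiffness, add_sub_cancel_left, abs_div, abs_mul, abs_of_nonneg hε, abs_two]
  have := H.abs_ks_le x
  gcongr

/-- The condition `ε * M ≤ k₀` confines the perturbation of the stiffness to `k₀ / 2`. It does not
involve `N`. -/
theorem le_stiffness (H : MistuningData k₀ κ M km ks) (hε : 0 ≤ ε) (hεM : ε * M ≤ k₀) (x : ℝ) :
    k₀ / 2 ≤ stiffness k₀ ε ks x := by
  linarith [(abs_le.1 (H.abs_stiffness_sub_le hε x)).1]

theorem stiffness_le (H : MistuningData k₀ κ M km ks) (hε : 0 ≤ ε) (hεM : ε * M ≤ k₀) (x : ℝ) :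
    stiffness k₀ ε ks x ≤ 3 * k₀ / 2 := by
  linarith [(abs_le.1 (H.abs_stiffness_sub_le hε x)).2]

theorem stiffness_pos (H : MistuningData k₀ κ M km ks) (hε : 0 ≤ ε) (hεM : ε * M ≤ k₀) (x : ℝ) :
    0 < stiffness k₀ ε ks x := (half_pos H.k₀_pos).trans_le (H.le_stiffness hε hεM x)

theorem abs_damping_le (H : MistuningData k₀ κ M km ks) (hε : 0 ≤ ε) (hεM : ε * M ≤ k₀) (x : ℝ) :
    |pruferDamping k₀ ρ ε km ks x| ≤ |ε * ρ| * M / (k₀ / 2) :=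
  abs_pruferDamping_le (H.abs_km_le x) (half_pos H.k₀_pos) (H.le_stiffness hε hεM x)

theorem abs_potential_le (H : MistuningData k₀ κ M km ks) (hε : 0 ≤ ε) (hεM : ε * M ≤ k₀)
    (x : ℝ) : |pruferPotential k₀ κ ε lam ks x| ≤ |lam| / (κ * (k₀ / 2)) :=
  abs_pruferPotential_le H.κ_pos (half_pos H.k₀_pos) (H.le_stiffness hε hεM x)

theorem exists_angle (H : MistuningData k₀ κ M km ks) (hε : 0 ≤ ε) (hεM : ε * M ≤ k₀)
    (ρ lam : ℝ) : ∃ θ, IsPruferAngle (2 * π) κ (pruferDamping k₀ ρ ε km ks)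
      (pruferPotential k₀ κ ε lam ks) θ ∧ θ (2 * π) = endAngle k₀ κ ρ km ks ε lam := by
  have h : ∃ θ, IsPruferAngle (2 * π) κ (pruferDamping k₀ ρ ε km ks)
      (pruferPotential k₀ κ ε lam ks) θ :=
    exists_isPruferAngle (M := max (|ε * ρ| * M / (k₀ / 2)) (|lam| / (κ * (k₀ / 2))))
      (by positivity) H.κ_pos (measurable_pruferDamping H.measurable_km H.measurable_ks)
      (measurable_pruferPotential H.measurable_ks)
      (fun x => (H.abs_damping_le hε hεM x).trans (le_max_left _ _))
      (fun x => (H.abs_potential_le hε hεM x).trans (le_max_right _ _))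
  exact ⟨_, Classical.epsilon_spec h, rfl⟩

theorem endAngle_lt (H : MistuningData k₀ κ M km ks) (hε : 0 ≤ ε) (hεM : ε * M ≤ k₀)
    (h : lam < lam') : endAngle k₀ κ ρ km ks ε lam < endAngle k₀ κ ρ km ks ε lam' := by
  obtain ⟨θ, hθ, e⟩ := H.exists_angle hε hεM ρ lam
  obtain ⟨θ', hθ', e'⟩ := H.exists_angle hε hεM ρ lam'
  have hκ := H.κ_pos
  have hk₀ := H.k₀_pos
  rw [← e, ← e']
  set B := max (|ε * ρ| * M / (k₀ / 2)) (max (|lam| / (κ * (k₀ / 2))) (|lam'| / (κ * (k₀ / 2))))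
  refine IsPruferAngle.lt_of_lt (M := B) (c := (lam' - lam) / (κ * (3 * k₀ / 2))) (by positivity)
    H.κ_pos (measurable_pruferDamping H.measurable_km H.measurable_ks)
    (measurable_pruferPotential H.measurable_ks) (measurable_pruferPotential H.measurable_ks)
    (fun x => (H.abs_damping_le hε hεM x).trans (le_max_left _ _))
    (fun x => (H.abs_potential_le hε hεM x).trans ((le_max_left _ _).trans (le_max_right _ _)))
    (fun x => (H.abs_potential_le hε hεM x).trans ((le_max_right _ _).trans (le_max_right _ _)))
    hθ hθ' (div_pos (by linarith) (by positivity)) fun x => ?_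
  rw [pruferPotential, pruferPotential, ← sub_div]
  have h1 := H.stiffness_pos hε hεM x
  have h2 := H.stiffness_le hε hεM x
  have h3 : 0 ≤ lam' - lam := by linarith
  gcongr

theorem strictMono_endAngle (H : MistuningData k₀ κ M km ks) (hε : 0 ≤ ε) (hεM : ε * M ≤ k₀) :
    StrictMono (endAngle k₀ κ ρ km ks ε) := fun _ _ h => H.endAngle_lt hε hεM h

/-- At `lam = 0` the potential vanishes and the angle stays below `π / 2`, while `κ ≥ 1 / 2` makes
the target at least `π`. This is the lower end for the intermediate value theorem. -/
theorem endAngle_zero_lt (H : MistuningData k₀ κ M km ks) (hε : 0 ≤ ε) (hεM : ε * M ≤ k₀) :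
    endAngle k₀ κ ρ km ks ε 0 < κ * (2 * π) := by
  obtain ⟨θ, hθ, e⟩ := H.exists_angle hε hεM ρ 0
  have h0 : pruferPotential k₀ κ ε 0 ks = 0 := by
    ext x
    simp [pruferPotential]
  rw [h0] at hθ
  have h1 := hθ.lt_pi_div_two (by positivity)
    (measurable_pruferDamping H.measurable_km H.measurable_ks) (H.abs_damping_le hε hεM)
  rw [← e]
  nlinarith [H.half_le, Real.pi_pos]

/-- The upper end for the intermediate value theorem. The value of `lam` is what `le_of_large`
needs: divided by `κ * (3 k₀ / 2)`, its two terms are `2 κ` and the bound for `P² / (2 κ)`. Its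
growth like `(ε ρ)²` is what the expansion of `ν` tolerates. -/
theorem le_endAngle (H : MistuningData k₀ κ M km ks) (hε : 0 ≤ ε) (hεM : ε * M ≤ k₀) :
    κ * (2 * π) ≤
      endAngle k₀ κ ρ km ks ε (3 * κ ^ 2 * k₀ + 3 * (ε * ρ) ^ 2 * M ^ 2 / k₀) := by
  obtain ⟨θ, hθ, e⟩ := H.exists_angle hε hεM ρ (3 * κ ^ 2 * k₀ + 3 * (ε * ρ) ^ 2 * M ^ 2 / k₀)
  have hκ := H.κ_pos
  have hk₀ := H.k₀_pos
  rw [← e]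
  refine hθ.le_of_large (by positivity) hκ (fun x => ?_) H.sin_eq_zero
  have h1 := H.le_stiffness hε hεM x
  have h2 := H.stiffness_le hε hεM x
  have h3 : pruferDamping k₀ ρ ε km ks x ^ 2 ≤ (|ε * ρ| * M / (k₀ / 2)) ^ 2 :=
    sq_le_sq' (by linarith [(abs_le.1 (H.abs_damping_le (ρ := ρ) hε hεM x)).1])
      (abs_le.1 (H.abs_damping_le hε hεM x)).2
  have h4 : (|ε * ρ| * M / (k₀ / 2)) ^ 2 = 4 * (ε * ρ) ^ 2 * M ^ 2 / k₀ ^ 2 := by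
    rw [div_pow, mul_pow, sq_abs]
    field_simp
    ring
  have h5 : (3 * κ ^ 2 * k₀ + 3 * (ε * ρ) ^ 2 * M ^ 2 / k₀) / (κ * (3 * k₀ / 2)) ≤
      pruferPotential k₀ κ ε (3 * κ ^ 2 * k₀ + 3 * (ε * ρ) ^ 2 * M ^ 2 / k₀) ks x := by
    rw [pruferPotential]
    have : 0 < stiffness k₀ ε ks x := by linarith
    gcongr
  have h6 : (3 * κ ^ 2 * k₀ + 3 * (ε * ρ) ^ 2 * M ^ 2 / k₀) / (κ * (3 * k₀ / 2)) =
      2 * κ + 4 * (ε * ρ) ^ 2 * M ^ 2 / k₀ ^ 2 / (2 * κ) := by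
    field_simp
    ring
  have h7 : pruferDamping k₀ ρ ε km ks x ^ 2 / (2 * κ) ≤
      4 * (ε * ρ) ^ 2 * M ^ 2 / k₀ ^ 2 / (2 * κ) := by
    rw [← h4]
    gcongr
  linarith

/-- The end angle is locally Lipschitz in the parameters. -/
theorem exists_abs_endAngle_sub_le (H : MistuningData k₀ κ M km ks) (hε : 0 ≤ ε)
    (hεM : ε * M ≤ k₀) (ρ lam : ℝ) : ∃ K, ∀ ε' lam', 0 ≤ ε' → ε' * M ≤ k₀ →
      |endAngle k₀ κ ρ km ks ε' lam' - endAngle k₀ κ ρ km ks ε lam| ≤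
        K * (|ε' - ε| + |lam' - lam|) := by
  have hκ := H.κ_pos
  have hk₀ := H.k₀_pos
  have hM := H.bound_pos
  -- `abs_sub_le` needs bounds on one of the two coefficient pairs only, so the constant depends on
  -- the base point `(ε, lam)` and `lam'` is unrestricted.
  set B := max (|ε * ρ| * M / (k₀ / 2)) (|lam| / (κ * (k₀ / 2))) with hB
  set L := exp ((|κ| + 2 * B) * (2 * π))
  set K₀ : ℝ := |ρ| * M * k₀ * (4 / k₀ ^ 2) + (2 / k₀ + |lam| * (M / 2) * (4 / k₀ ^ 2)) / κ with hK₀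
  refine ⟨L * (L * (K₀ + K₀) * (2 * π)), fun ε' lam' hε' hεM' => ?_⟩
  obtain ⟨θ, hθ, e⟩ := H.exists_angle hε hεM ρ lam
  obtain ⟨θ', hθ', e'⟩ := H.exists_angle hε' hεM' ρ lam'
  rw [← e, ← e']
  have hApos (x : ℝ) : 0 < stiffness k₀ ε ks x := H.stiffness_pos hε hεM x
  have hApos' (x : ℝ) : 0 < stiffness k₀ ε' ks x := H.stiffness_pos hε' hεM' x
  have hAA (x : ℝ) : 1 / (stiffness k₀ ε' ks x * stiffness k₀ ε ks x) ≤ 4 / k₀ ^ 2 := by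
    have h1 := H.le_stiffness hε hεM x
    have h2 := H.le_stiffness hε' hεM' x
    have h3 := (hApos' x).le
    calc 1 / (stiffness k₀ ε' ks x * stiffness k₀ ε ks x) ≤ 1 / (k₀ / 2 * (k₀ / 2)) := by gcongr
      _ = 4 / k₀ ^ 2 := by field_simp; norm_num
  have key := IsPruferAngle.abs_sub_le (M := B) (d := K₀ * (|ε' - ε| + |lam' - lam|))
    (by positivity)
    (measurable_pruferDamping H.measurable_km H.measurable_ks)
    (measurable_pruferPotential H.measurable_ks)
    (fun x => (H.abs_damping_le hε hεM x).trans (le_max_left _ _))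
    (fun x => (H.abs_potential_le hε hεM x).trans (le_max_right _ _)) hθ hθ'
    (fun x => ?_) (fun x => ?_)
  · refine key.trans_eq ?_
    ring
  · have h1 : pruferDamping k₀ ρ ε' km ks x - pruferDamping k₀ ρ ε km ks x =
        (ε' - ε) * (ρ * km x * k₀ * (1 / (stiffness k₀ ε' ks x * stiffness k₀ ε ks x))) := by
      have a := (hApos x).ne'
      have a' := (hApos' x).ne'
      simp only [pruferDamping]
      field_simp
      simp only [stiffness]
      ring
    rw [h1, abs_mul, abs_mul, abs_mul, abs_mul, abs_of_pos hk₀, abs_of_pos (a := 1 / _)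
      (by have := hApos x; have := hApos' x; positivity)]
    have h2 : |ρ| * |km x| * k₀ * (1 / (stiffness k₀ ε' ks x * stiffness k₀ ε ks x)) ≤ K₀ := by
      rw [hK₀]
      refine le_add_of_le_of_nonneg ?_ (by positivity)
      have := hAA x
      have := H.abs_km_le x
      have := (one_div_pos.2 (mul_pos (hApos' x) (hApos x))).le
      gcongr
    rw [mul_comm K₀]
    refine mul_le_mul (le_add_of_nonneg_right (abs_nonneg _)) h2 ?_ (by positivity)
    have := hApos x
    have := hApos' x
    positivity
  · have h1 : pruferPotential k₀ κ ε' lam' ks x - pruferPotential k₀ κ ε lam ks x =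
        ((lam' - lam) * (1 / stiffness k₀ ε' ks x) + lam * ((ε - ε') * (ks x / 2) *
          (1 / (stiffness k₀ ε' ks x * stiffness k₀ ε ks x)))) / κ := by
      have a := (hApos x).ne'
      have a' := (hApos' x).ne'
      simp only [pruferPotential]
      field_simp
      simp only [stiffness]
      ring
    have hb1 : 1 / stiffness k₀ ε' ks x ≤ 2 / k₀ := by
      rw [div_le_div_iff₀ (hApos' x) hk₀]
      linarith [H.le_stiffness hε' hεM' x]
    have hb0 := (one_div_pos.2 (hApos' x)).le
    have hb2 := (one_div_pos.2 (mul_pos (hApos' x) (hApos x))).le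
    rw [h1, abs_div, abs_of_pos hκ]
    have h2 : |(lam' - lam) * (1 / stiffness k₀ ε' ks x) + lam * ((ε - ε') * (ks x / 2) *
          (1 / (stiffness k₀ ε' ks x * stiffness k₀ ε ks x)))| ≤
        |lam' - lam| * (2 / k₀) + |lam| * (|ε' - ε| * (M / 2) * (4 / k₀ ^ 2)) := by
      refine (abs_add_le _ _).trans ?_
      rw [abs_mul, abs_mul, abs_mul, abs_mul, abs_of_nonneg hb0,
        abs_of_nonneg hb2, abs_sub_comm ε ε', abs_div (ks x), abs_two]
      have := hAA x
      have := H.abs_ks_le x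
      gcongr
    calc _ ≤ (|lam' - lam| * (2 / k₀) + |lam| * (|ε' - ε| * (M / 2) * (4 / k₀ ^ 2))) / κ := by
          gcongr
      _ ≤ ((|ε' - ε| + |lam' - lam|) * (2 / k₀) +
            |lam| * ((|ε' - ε| + |lam' - lam|) * (M / 2) * (4 / k₀ ^ 2))) / κ := by
          gcongr
          · exact le_add_of_nonneg_left (abs_nonneg _)
          · exact le_add_of_nonneg_right (abs_nonneg _)
      _ = (2 / k₀ + |lam| * (M / 2) * (4 / k₀ ^ 2)) / κ * (|ε' - ε| + |lam' - lam|) := by ring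
      _ ≤ K₀ * (|ε' - ε| + |lam' - lam|) := by
          gcongr
          rw [hK₀]
          exact le_add_of_nonneg_left (by positivity)

theorem continuousOn_endAngle (H : MistuningData k₀ κ M km ks) (ρ : ℝ) {S : Set ℝ}
    (hS : ∀ ε ∈ S, 0 ≤ ε ∧ ε * M ≤ k₀) {g : ℝ → ℝ} (hg : ContinuousOn g S) :
    ContinuousOn (fun ε => endAngle k₀ κ ρ km ks ε (g ε)) S := by
  intro ε hε
  obtain ⟨K, hK⟩ := H.exists_abs_endAngle_sub_le (hS ε hε).1 (hS ε hε).2 ρ (g ε)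
  rw [ContinuousWithinAt, tendsto_iff_dist_tendsto_zero]
  have hlim : Filter.Tendsto (fun ε' => K * (|ε' - ε| + |g ε' - g ε|)) (nhdsWithin ε S) (nhds 0) := by
    have h1 : ContinuousWithinAt (fun ε' => K * (|ε' - ε| + |g ε' - g ε|)) S ε := by
      have := hg ε hε
      fun_prop
    simpa [ContinuousWithinAt] using h1
  refine squeeze_zero' (Filter.Eventually.of_forall fun _ => dist_nonneg) ?_ hlim
  filter_upwards [self_mem_nhdsWithin] with ε' hε'
  exact hK ε' (g ε') (hS ε' hε').1 (hS ε' hε').2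

theorem continuous_endAngle (H : MistuningData k₀ κ M km ks) (hε : 0 ≤ ε) (hεM : ε * M ≤ k₀) :
    Continuous (endAngle k₀ κ ρ km ks ε) := by
  rw [continuous_iff_continuousAt]
  intro lam
  obtain ⟨K, hK⟩ := H.exists_abs_endAngle_sub_le hε hεM ρ lam
  rw [ContinuousAt, tendsto_iff_dist_tendsto_zero]
  refine squeeze_zero (g := fun lam' => K * |lam' - lam|) (fun _ => dist_nonneg) (fun lam' => ?_) ?_
  · simpa [Real.dist_eq] using hK ε lam' hε hεM
  · have h1 : Continuous fun lam' => K * |lam' - lam| := by fun_prop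
    simpa using h1.tendsto lam

end MistuningData

/-! ### First order expansion and the branch of spectral parameters -/

/-- The first order coefficient of the spectral parameter with respect to the damping. -/
noncomputable def dampingCoeff (κ : ℝ) (km : ℝ → ℝ) : ℝ :=
  -(κ / π) * ∫ x in (0 : ℝ)..(2 * π), km x * (sin (κ * x) * cos (κ * x))

/-- The first order coefficient of the spectral parameter with respect to the stiffness. -/
noncomputable def stiffnessCoeff (κ : ℝ) (ks : ℝ → ℝ) : ℝ :=
  κ ^ 2 / (2 * π) * ∫ x in (0 : ℝ)..(2 * π), ks x * sin (κ * x) ^ 2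

namespace MistuningData

variable {k₀ κ M ρ ε ε' lam lam' : ℝ} {km ks : ℝ → ℝ}

theorem integral_sin_sq (H : MistuningData k₀ κ M km ks) :
    ∫ x in (0 : ℝ)..(2 * π), sin (κ * x) ^ 2 = π := by
  have hκ := H.κ_pos
  rw [intervalIntegral.integral_comp_mul_left (fun y => sin y ^ 2) hκ.ne', _root_.integral_sin_sq]
  simp [H.sin_eq_zero]
  field_simp

/-- The linear part of the end angle. `dampingCoeff` and `stiffnessCoeff` are normalized so that it
vanishes precisely at `Λ = ε ρ a + ε b`. -/
theorem integral_first_order (H : MistuningData k₀ κ M km ks) (ρ ε Λ : ℝ) :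
    ∫ x in (0 : ℝ)..(2 * π), (ε * ρ * km x * (sin (κ * x) * cos (κ * x)) +
      (Λ - κ ^ 2 * (ε * ks x / 2)) / κ * sin (κ * x) ^ 2) / k₀ =
      π / (k₀ * κ) * (Λ - ε * ρ * dampingCoeff κ km - ε * stiffnessCoeff κ ks) := by
  have hκ := H.κ_pos
  have hk₀ := H.k₀_pos
  have hi₁ : IntervalIntegrable (fun x => km x * (sin (κ * x) * cos (κ * x))) volume 0 (2 * π) :=
    (intervalIntegrable_of_measurable_of_bounded H.measurable_km H.abs_km_le _ _).mul_continuousOn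
      (by fun_prop)
  have hi₂ : IntervalIntegrable (fun x => ks x * sin (κ * x) ^ 2) volume 0 (2 * π) :=
    (intervalIntegrable_of_measurable_of_bounded H.measurable_ks H.abs_ks_le _ _).mul_continuousOn
      (by fun_prop)
  have hi₃ : IntervalIntegrable (fun x => sin (κ * x) ^ 2) volume 0 (2 * π) :=
    Continuous.intervalIntegrable (by fun_prop) _ _
  have h1 : ∀ x, (ε * ρ * km x * (sin (κ * x) * cos (κ * x)) +
      (Λ - κ ^ 2 * (ε * ks x / 2)) / κ * sin (κ * x) ^ 2) / k₀ =
      ε * ρ / k₀ * (km x * (sin (κ * x) * cos (κ * x))) + Λ / (k₀ * κ) * sin (κ * x) ^ 2 -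
      κ * ε / (2 * k₀) * (ks x * sin (κ * x) ^ 2) := by
    intro x
    field_simp
    ring
  simp only [h1]
  rw [intervalIntegral.integral_sub ((hi₁.const_mul _).add (hi₃.const_mul _)) (hi₂.const_mul _),
    intervalIntegral.integral_add (hi₁.const_mul _) (hi₃.const_mul _),
    intervalIntegral.integral_const_mul, intervalIntegral.integral_const_mul,
    intervalIntegral.integral_const_mul, H.integral_sin_sq, dampingCoeff, stiffnessCoeff]
  field_simp
  ring

/-- First order expansion of the end angle, uniform in the density. -/
theorem exists_endAngle_expansion (H : MistuningData k₀ κ M km ks) :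
    ∃ K, 0 < K ∧ ∀ ρ ε Λ : ℝ, 1 ≤ ρ → 0 ≤ ε → ε * M ≤ k₀ →
      |endAngle k₀ κ ρ km ks ε (k₀ * κ ^ 2 + Λ) - κ * (2 * π) -
        π / (k₀ * κ) * (Λ - ε * ρ * dampingCoeff κ km - ε * stiffnessCoeff κ ks)| ≤
        K * (ε * ρ + |Λ|) ^ 2 := by
  have hκ := H.κ_pos
  have hk₀ := H.k₀_pos
  have hM := H.bound_pos
  -- Collects the bounds on the numerators of `P` and `Q - κ`, so that both coefficients are at most
  -- `(2 c / k₀) (ε ρ + |Λ|)`. The assumption `ρ ≥ 1` enters through `ε ≤ ε ρ`.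
  set c : ℝ := M + 1 / κ + κ * M / 2 with hc
  have hc0 : 0 < c := by positivity
  refine ⟨4 * (2 * c / k₀) ^ 2 * (2 * π) ^ 2 + M * c / k₀ ^ 2 * (2 * π), by positivity,
    fun ρ ε Λ hρ hε hεM => ?_⟩
  obtain ⟨θ, hθ, e⟩ := H.exists_angle hε hεM ρ (k₀ * κ ^ 2 + Λ)
  rw [← e]
  set δ := ε * ρ with hδ
  have hδ0 : 0 ≤ δ := by positivity
  have hεδ : ε ≤ δ := le_mul_of_one_le_right hε hρ
  set A := stiffness k₀ ε ks with hA
  have hApos (x : ℝ) : 0 < A x := H.stiffness_pos hε hεM x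
  have hinv (x : ℝ) : 1 / A x ≤ 2 / k₀ := by
    rw [div_le_div_iff₀ (hApos x) hk₀]
    linarith [H.le_stiffness hε hεM x]
  have hpot (x : ℝ) : pruferPotential k₀ κ ε (k₀ * κ ^ 2 + Λ) ks x - κ =
      (Λ - κ ^ 2 * (ε * ks x / 2)) / κ * (1 / A x) := by
    have := (hApos x).ne'
    rw [pruferPotential, ← hA]
    field_simp
    simp only [hA, stiffness]
    ring
  have hdam (x : ℝ) : pruferDamping k₀ ρ ε km ks x = δ * km x * (1 / A x) := by
    rw [pruferDamping, mul_one_div]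
  have hb₁ (x : ℝ) : |δ * km x| ≤ M * δ := by
    rw [abs_mul, abs_of_nonneg hδ0, mul_comm]
    gcongr
    exact H.abs_km_le x
  have hb₂ (x : ℝ) : |(Λ - κ ^ 2 * (ε * ks x / 2)) / κ| ≤ |Λ| / κ + κ * M / 2 * δ := by
    have h1 : (Λ - κ ^ 2 * (ε * ks x / 2)) / κ = Λ / κ - κ * (ε * ks x) / 2 := by field_simp
    rw [h1]
    refine (abs_sub _ _).trans ?_
    rw [abs_div, abs_of_pos hκ, abs_div, abs_mul, abs_mul, abs_two, abs_of_pos hκ,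
      abs_of_nonneg hε, mul_div_right_comm κ M 2, mul_div_right_comm κ _ 2, mul_assoc _ M δ,
      mul_comm M δ]
    have := H.abs_ks_le x
    gcongr
  have hinv0 (x : ℝ) : 0 ≤ 1 / A x := (one_div_pos.2 (hApos x)).le
  have hΛ := abs_nonneg Λ
  have hκi : 0 < 1 / κ := by positivity
  have hκM : 0 < κ * M / 2 := by positivity
  have hsum : M * δ + (|Λ| / κ + κ * M / 2 * δ) ≤ c * (δ + |Λ|) := by
    have h1 : |Λ| / κ = 1 / κ * |Λ| := by ring
    rw [h1, hc]
    nlinarith [mul_nonneg hM.le hΛ, mul_nonneg hκi.le hδ0, mul_nonneg hκM.le hΛ]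
  clear_value c
  have hbδ : 0 ≤ |Λ| / κ := by positivity
  have hbδ' : 0 ≤ κ * M / 2 * δ := by positivity
  have hMδ : 0 ≤ M * δ := by positivity
  have hcΛ : 0 ≤ c * (δ + |Λ|) := by positivity
  have key := hθ.abs_sub_first_order_le (a := 2 * c / k₀ * (δ + |Λ|)) (by positivity)
    (measurable_pruferDamping H.measurable_km H.measurable_ks)
    (measurable_pruferPotential H.measurable_ks) (fun x => by
      rw [hdam, abs_mul, abs_of_nonneg (hinv0 x)]
      calc |δ * km x| * (1 / A x) ≤ c * (δ + |Λ|) * (2 / k₀) :=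
            mul_le_mul (by linarith [hb₁ x]) (hinv x) (hinv0 x) hcΛ
        _ = _ := by ring) (fun x => by
      rw [hpot, abs_mul, abs_of_nonneg (hinv0 x)]
      calc |(Λ - κ ^ 2 * (ε * ks x / 2)) / κ| * (1 / A x) ≤ c * (δ + |Λ|) * (2 / k₀) :=
            mul_le_mul (by linarith [hb₂ x]) (hinv x) (hinv0 x) hcΛ
        _ = _ := by ring)
  -- Freezing `1 / A` at `1 / k₀` costs a relative error `|k₀ - A| / A = O(ε)` on an integrand of
  -- size `O(ε ρ + |Λ|)`, which is again quadratic.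
  have hD : |(∫ x in (0 : ℝ)..(2 * π), (pruferDamping k₀ ρ ε km ks x * (sin (κ * x) * cos (κ * x)) +
      (pruferPotential k₀ κ ε (k₀ * κ ^ 2 + Λ) ks x - κ) * sin (κ * x) ^ 2)) -
      ∫ x in (0 : ℝ)..(2 * π), (δ * km x * (sin (κ * x) * cos (κ * x)) +
        (Λ - κ ^ 2 * (ε * ks x / 2)) / κ * sin (κ * x) ^ 2) / k₀| ≤
      M * δ / k₀ ^ 2 * (c * (δ + |Λ|)) * (2 * π) := by
    rw [← intervalIntegral.integral_sub, ← Real.norm_eq_abs]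
    · refine (intervalIntegral.norm_integral_le_of_norm_le_const
        (C := M * δ / k₀ ^ 2 * (c * (δ + |Λ|))) fun x _ => ?_).trans_eq
        (by rw [sub_zero, abs_of_pos (show (0 : ℝ) < 2 * π by positivity)])
      have h1 : pruferDamping k₀ ρ ε km ks x * (sin (κ * x) * cos (κ * x)) +
          (pruferPotential k₀ κ ε (k₀ * κ ^ 2 + Λ) ks x - κ) * sin (κ * x) ^ 2 -
          (δ * km x * (sin (κ * x) * cos (κ * x)) +
            (Λ - κ ^ 2 * (ε * ks x / 2)) / κ * sin (κ * x) ^ 2) / k₀ =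
          (k₀ - A x) * (1 / A x) * (1 / k₀) * (δ * km x * (sin (κ * x) * cos (κ * x)) +
            (Λ - κ ^ 2 * (ε * ks x / 2)) / κ * sin (κ * x) ^ 2) := by
        have := (hApos x).ne'
        rw [hdam, hpot]
        field_simp
      rw [h1, Real.norm_eq_abs, abs_mul]
      refine mul_le_mul ?_ ?_ (abs_nonneg _) (by positivity)
      · rw [abs_mul, abs_mul, abs_of_nonneg (hinv0 x), abs_of_pos (one_div_pos.2 hk₀),
          abs_sub_comm]
        have h2 : |A x - k₀| ≤ M * δ / 2 := (H.abs_stiffness_sub_le hε x).trans (by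
          rw [mul_comm]; gcongr)
        have h3 := hinv x
        have h4 := hinv0 x
        calc |A x - k₀| * (1 / A x) * (1 / k₀) ≤ M * δ / 2 * (2 / k₀) * (1 / k₀) := by gcongr
          _ = M * δ / k₀ ^ 2 := by field_simp
      · refine (abs_add_le _ _).trans (le_trans (add_le_add ?_ ?_) hsum)
        · rw [abs_mul, abs_mul (sin _)]
          exact (mul_le_of_le_one_right (abs_nonneg _) (mul_le_one₀ (abs_sin_le_one _)
            (abs_nonneg _) (abs_cos_le_one _))).trans (hb₁ x)
        · rw [abs_mul, abs_of_nonneg (sq_nonneg (sin (κ * x)))]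
          exact (mul_le_of_le_one_right (abs_nonneg _) (sin_sq_le_one _)).trans (hb₂ x)
    · exact ((intervalIntegrable_of_measurable_of_bounded
        (measurable_pruferDamping H.measurable_km H.measurable_ks) (H.abs_damping_le hε hεM) _
        _).mul_continuousOn (by fun_prop)).add
        (((intervalIntegrable_of_measurable_of_bounded (measurable_pruferPotential H.measurable_ks)
          (H.abs_potential_le hε hεM) _ _).sub intervalIntegrable_const).mul_continuousOn
          (by fun_prop))
    · refine IntervalIntegrable.div_const (IntervalIntegrable.add ?_ ?_) _
      · exact ((intervalIntegrable_of_measurable_of_bounded H.measurable_km H.abs_km_le _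
          _).const_mul δ).mul_continuousOn (by fun_prop)
      · exact ((intervalIntegrable_const.sub
          (((intervalIntegrable_of_measurable_of_bounded H.measurable_ks H.abs_ks_le _
          _).const_mul ε).div_const 2 |>.const_mul (κ ^ 2))).div_const κ).mul_continuousOn
          (by fun_prop)
  rw [H.integral_first_order] at hD
  have hfin : M * δ / k₀ ^ 2 * (c * (δ + |Λ|)) * (2 * π) ≤
      M * c / k₀ ^ 2 * (2 * π) * (δ + |Λ|) ^ 2 := by
    calc M * δ / k₀ ^ 2 * (c * (δ + |Λ|)) * (2 * π)
        ≤ M * (δ + |Λ|) / k₀ ^ 2 * (c * (δ + |Λ|)) * (2 * π) := by gcongr; linarith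
      _ = _ := by ring
  calc |θ (2 * π) - κ * (2 * π) -
        π / (k₀ * κ) * (Λ - δ * dampingCoeff κ km - ε * stiffnessCoeff κ ks)|
      ≤ 4 * (2 * c / k₀ * (δ + |Λ|)) ^ 2 * (2 * π) ^ 2 +
        M * δ / k₀ ^ 2 * (c * (δ + |Λ|)) * (2 * π) := by
        refine le_trans ?_ (add_le_add key hD)
        refine le_trans (le_of_eq ?_) (abs_add_le _ _)
        congr 1
        ring
    _ ≤ _ := by
        linarith

theorem endAngle_nominal (H : MistuningData k₀ κ M km ks) (hρ : 1 ≤ ρ) :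
    endAngle k₀ κ ρ km ks 0 (k₀ * κ ^ 2) = κ * (2 * π) := by
  obtain ⟨K, -, hK⟩ := H.exists_endAngle_expansion
  have h1 := hK ρ 0 0 hρ le_rfl (by linarith [H.k₀_pos])
  simp only [add_zero, zero_mul, sub_zero, mul_zero, abs_zero] at h1
  have h2 : |endAngle k₀ κ ρ km ks 0 (k₀ * κ ^ 2) - κ * (2 * π)| ≤ 0 := by simpa using h1
  linarith [abs_nonpos_iff.1 h2]

/-- The spectral parameter whose Prüfer angle ends at `2 π κ`: it is unique, continuous in `ε`, and
has a first order expansion that is uniform in the density. -/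
theorem exists_spectralBranch (H : MistuningData k₀ κ M km ks) :
    ∃ K, 0 < K ∧ ∀ ρ : ℝ, 1 ≤ ρ → ∃ ν : ℝ → ℝ, ContinuousOn ν {ε | 0 ≤ ε ∧ ε * M ≤ k₀} ∧
      ν 0 = k₀ * κ ^ 2 ∧ ∀ ε, 0 ≤ ε → ε * M ≤ k₀ →
        (∀ lam, endAngle k₀ κ ρ km ks ε lam = κ * (2 * π) ↔ lam = ν ε) ∧
        |ν ε - k₀ * κ ^ 2 - ε * ρ * dampingCoeff κ km - ε * stiffnessCoeff κ ks| ≤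
          K * (ε * ρ) ^ 2 := by
  have hκ := H.κ_pos
  have hk₀ := H.k₀_pos
  have hM := H.bound_pos
  obtain ⟨K₁, hK₁, hexp⟩ := H.exists_endAngle_expansion
  set a := dampingCoeff κ km with ha
  set b := stiffnessCoeff κ ks with hb
  set B := |a| + |b| with hB
  have hB0 : 0 ≤ B := by positivity
  set r := π / (k₀ * κ) with hr
  have hr0 : 0 < r := by positivity
  set δ₁ := r / (2 * (K₁ * (2 + B) ^ 2)) with hδ₁
  have hδ₁0 : 0 < δ₁ := by positivity
  -- The first summand serves `ε ρ ≤ δ₁`, the bracket serves `ε ρ > δ₁`.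
  set K := K₁ * (2 + B) ^ 2 / r + (4 * κ ^ 2 * k₀ / δ₁ ^ 2 + 3 * M ^ 2 / k₀ + B / δ₁) with hK
  refine ⟨K, by positivity, fun ρ hρ => ?_⟩
  have hex : ∀ ε, ∃ ν, 0 ≤ ε → ε * M ≤ k₀ → 0 < ν ∧
      ν ≤ 3 * κ ^ 2 * k₀ + 3 * (ε * ρ) ^ 2 * M ^ 2 / k₀ ∧
      endAngle k₀ κ ρ km ks ε ν = κ * (2 * π) := by
    intro ε
    by_cases h : 0 ≤ ε ∧ ε * M ≤ k₀
    · obtain ⟨hε, hεM⟩ := h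
      have h0 := H.endAngle_zero_lt (ρ := ρ) hε hεM
      have h1 := H.le_endAngle (ρ := ρ) hε hεM
      obtain ⟨ν, hν, hνe⟩ := intermediate_value_Icc (by positivity)
        (H.continuous_endAngle (ρ := ρ) hε hεM).continuousOn ⟨h0.le, h1⟩
      refine ⟨ν, fun _ _ => ⟨lt_of_le_of_ne hν.1 ?_, hν.2, hνe⟩⟩
      rintro rfl
      exact h0.ne hνe
    · exact ⟨0, fun h1 h2 => absurd ⟨h1, h2⟩ h⟩
  choose ν hν using hex
  have hmono {ε : ℝ} (hε : 0 ≤ ε) (hεM : ε * M ≤ k₀) :=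
    H.strictMono_endAngle (ρ := ρ) hε hεM
  have huniq : ∀ ε, 0 ≤ ε → ε * M ≤ k₀ → ∀ lam,
      endAngle k₀ κ ρ km ks ε lam = κ * (2 * π) ↔ lam = ν ε := by
    intro ε hε hεM lam
    rw [← (hν ε hε hεM).2.2]
    exact (hmono hε hεM).injective.eq_iff
  have hν0 : ν 0 = k₀ * κ ^ 2 :=
    ((huniq 0 le_rfl (by linarith) _).1 (H.endAngle_nominal hρ)).symm
  refine ⟨ν, ?_, hν0, fun ε hε hεM => ⟨huniq ε hε hεM, ?_⟩⟩
  · intro ε hε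
    -- By monotonicity, `y < ν ε` says that the end angle at `y` lies below `2 π κ`. This is an open
    -- condition on `ε`, and likewise for `ν ε < y`.
    rw [ContinuousWithinAt, tendsto_order]
    constructor
    · intro y hy
      have h1 := (H.continuousOn_endAngle ρ (S := {ε | 0 ≤ ε ∧ ε * M ≤ k₀}) (fun _ h => h)
        (continuousOn_const (c := y))) ε hε
      have h2 : endAngle k₀ κ ρ km ks ε y < κ * (2 * π) := by
        rw [← (hν ε hε.1 hε.2).2.2]
        exact hmono hε.1 hε.2 hy
      filter_upwards [h1.eventually (gt_mem_nhds h2), self_mem_nhdsWithin] with ε' h3 hε'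
      rw [← (hν ε' hε'.1 hε'.2).2.2] at h3
      exact (hmono hε'.1 hε'.2).lt_iff_lt.1 h3
    · intro y hy
      have h1 := (H.continuousOn_endAngle ρ (S := {ε | 0 ≤ ε ∧ ε * M ≤ k₀}) (fun _ h => h)
        (continuousOn_const (c := y))) ε hε
      have h2 : κ * (2 * π) < endAngle k₀ κ ρ km ks ε y := by
        rw [← (hν ε hε.1 hε.2).2.2]
        exact hmono hε.1 hε.2 hy
      filter_upwards [h1.eventually (lt_mem_nhds h2), self_mem_nhdsWithin] with ε' h3 hε'
      rw [← (hν ε' hε'.1 hε'.2).2.2] at h3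
      exact (hmono hε'.1 hε'.2).lt_iff_lt.1 h3
  · set δ := ε * ρ with hδ
    have hδ0 : 0 ≤ δ := by positivity
    have hεδ : ε ≤ δ := le_mul_of_one_le_right hε hρ
    have hlin : |δ * a + ε * b| ≤ B * δ := by
      refine (abs_add_le _ _).trans ?_
      rw [abs_mul δ a, abs_mul ε b, abs_of_nonneg hδ0, abs_of_nonneg hε, hB, add_mul, mul_comm δ,
        mul_comm ε]
      gcongr
    have hlin' := abs_le.1 hlin
    rcases hδ0.eq_or_lt with h0 | hδpos
    · have hε0 : ε = 0 := by linarith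
      simp [hε0, hν0, ← h0]
    rcases le_or_gt δ δ₁ with hsmall | hlarge
    · have hquad : K₁ * (2 + B) ^ 2 * δ ^ 2 < r * δ := by
        have h1 : K₁ * (2 + B) ^ 2 * δ ≤ r / 2 := by
          calc K₁ * (2 + B) ^ 2 * δ ≤ K₁ * (2 + B) ^ 2 * δ₁ := by gcongr
            _ = r / 2 := by rw [hδ₁]; field_simp
        nlinarith
      have hsq (Λ : ℝ) (hΛ : |Λ| ≤ (B + 1) * δ) :
          K₁ * (δ + |Λ|) ^ 2 ≤ K₁ * (2 + B) ^ 2 * δ ^ 2 := by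
        calc K₁ * (δ + |Λ|) ^ 2 ≤ K₁ * (δ + (B + 1) * δ) ^ 2 := by gcongr
          _ = _ := by ring
      have hup : ν ε < k₀ * κ ^ 2 + (B + 1) * δ := by
        rw [← (hmono hε hεM).lt_iff_lt, (hν ε hε hεM).2.2]
        have habs : |(B + 1) * δ| = (B + 1) * δ := abs_of_nonneg (by positivity)
        have h1 := (abs_le.1 (hexp ρ ε ((B + 1) * δ) hρ hε hεM)).1
        have h2 := hsq _ habs.le
        have h3 : r * δ ≤ r * ((B + 1) * δ - δ * a - ε * b) :=
          mul_le_mul_of_nonneg_left (by linarith) hr0.le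
        linarith
      have hlo : k₀ * κ ^ 2 + -((B + 1) * δ) < ν ε := by
        rw [← (hmono hε hεM).lt_iff_lt, (hν ε hε hεM).2.2]
        have habs : |-((B + 1) * δ)| = (B + 1) * δ := by
          rw [abs_neg]; exact abs_of_nonneg (by positivity)
        have h1 := (abs_le.1 (hexp ρ ε (-((B + 1) * δ)) hρ hε hεM)).2
        have h2 := hsq _ habs.le
        have h3 : r * (-((B + 1) * δ) - δ * a - ε * b) ≤ r * -δ :=
          mul_le_mul_of_nonneg_left (by linarith) hr0.le
        linarith
      have hΛ : |ν ε - k₀ * κ ^ 2| ≤ (B + 1) * δ := abs_le.2 ⟨by linarith, by linarith⟩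
      have h1 := hexp ρ ε (ν ε - k₀ * κ ^ 2) hρ hε hεM
      rw [add_sub_cancel, (hν ε hε hεM).2.2, sub_self, zero_sub, abs_neg, abs_mul,
        abs_of_pos hr0] at h1
      have h2 := h1.trans (hsq _ hΛ)
      rw [← le_div_iff₀' hr0] at h2
      refine h2.trans ?_
      rw [mul_div_right_comm, hK, add_mul]
      exact le_add_of_nonneg_right (by positivity)
    -- For `δ > δ₁` nothing is expanded: constants and multiples of `δ` are bounded by multiples of
    -- `δ²`, and `0 < ν ε = O(1 + δ²)` suffices.
    · have h1 := (hν ε hε hεM).1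
      have h2 := (hν ε hε hεM).2.1
      have hone : 1 ≤ δ / δ₁ := by rw [one_le_div hδ₁0]; exact hlarge.le
      have hone2 : 1 ≤ (δ / δ₁) ^ 2 := one_le_pow₀ hone
      have e1 : 4 * κ ^ 2 * k₀ ≤ 4 * κ ^ 2 * k₀ / δ₁ ^ 2 * δ ^ 2 := by
        calc 4 * κ ^ 2 * k₀ ≤ 4 * κ ^ 2 * k₀ * (δ / δ₁) ^ 2 :=
              le_mul_of_one_le_right (by positivity) hone2
          _ = _ := by rw [div_pow]; ring
      have e2 : B * δ ≤ B / δ₁ * δ ^ 2 := by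
        calc B * δ ≤ B * δ * (δ / δ₁) := le_mul_of_one_le_right (by positivity) hone
          _ = _ := by ring
      have e3 : 3 * δ ^ 2 * M ^ 2 / k₀ = 3 * M ^ 2 / k₀ * δ ^ 2 := by ring
      have e4 : 0 ≤ K₁ * (2 + B) ^ 2 / r * δ ^ 2 := by positivity
      have e5 : 0 ≤ 3 * M ^ 2 / k₀ * δ ^ 2 := by positivity
      have e6 : 0 ≤ κ ^ 2 * k₀ := by positivity
      have e7 : 0 ≤ B * δ := by positivity
      rw [e3] at h2
      have e8 : K * δ ^ 2 = K₁ * (2 + B) ^ 2 / r * δ ^ 2 + (4 * κ ^ 2 * k₀ / δ₁ ^ 2 * δ ^ 2 +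
          3 * M ^ 2 / k₀ * δ ^ 2 + B / δ₁ * δ ^ 2) := by rw [hK]; ring
      rw [e8, abs_le]
      constructor <;> linarith

end MistuningData

/-! ### Continuous branches of eigenvalues -/

theorem IsEigenvalueBranch.mono {b₀ k₀ E E' : ℝ} {km ks : ℝ → ℝ} {N : ℕ} {s₀ : ℂ} {s : ℝ → ℂ}
    (h : IsEigenvalueBranch b₀ k₀ km ks N s₀ E s) (hE : E' ≤ E) :
    IsEigenvalueBranch b₀ k₀ km ks N s₀ E' s :=
  ⟨h.continuousOn.mono (Icc_subset_Icc_right hE), h.start,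
    fun ε hε => h.isEigenvalue ε (Icc_subset_Icc_right hE hε)⟩

theorem IsTheEigenvalueBranch.mono {b₀ k₀ E E' : ℝ} {km ks : ℝ → ℝ} {N : ℕ} {s₀ : ℂ} {s : ℝ → ℂ}
    (h : IsTheEigenvalueBranch b₀ k₀ km ks N s₀ E s) (hE : E' ≤ E) :
    IsTheEigenvalueBranch b₀ k₀ km ks N s₀ E' s :=
  ⟨h.isBranch.mono hE, fun E₁ h0 h1 => h.unique E₁ h0 (h1.trans hE)⟩

theorem IsEigenvalueBranch.congr {b₀ k₀ E : ℝ} {km ks km' ks' : ℝ → ℝ} {N : ℕ} {s₀ : ℂ}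
    {s : ℝ → ℂ} (hkm : km =ᵐ[volume.restrict (Icc 0 (2 * π))] km')
    (hks : ks =ᵐ[volume.restrict (Icc 0 (2 * π))] ks')
    (h : IsEigenvalueBranch b₀ k₀ km ks N s₀ E s) : IsEigenvalueBranch b₀ k₀ km' ks' N s₀ E s :=
  ⟨h.continuousOn, h.start, fun ε hε => (h.isEigenvalue ε hε).congr hkm hks⟩

theorem IsTheEigenvalueBranch.congr {b₀ k₀ E : ℝ} {km ks km' ks' : ℝ → ℝ} {N : ℕ} {s₀ : ℂ}
    {s : ℝ → ℂ} (hkm : km =ᵐ[volume.restrict (Icc 0 (2 * π))] km')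
    (hks : ks =ᵐ[volume.restrict (Icc 0 (2 * π))] ks')
    (h : IsTheEigenvalueBranch b₀ k₀ km ks N s₀ E s) :
    IsTheEigenvalueBranch b₀ k₀ km' ks' N s₀ E s :=
  ⟨h.isBranch.congr hkm hks,
    fun E₁ h0 h1 t ht => h.unique E₁ h0 h1 t (ht.congr hkm.symm hks.symm)⟩

/-- The branches of eigenvalues `(-b₀ ± √(b₀² - 4 ν / ρ₀²)) / 2`, where `ν` is the branch of
spectral parameters; `σ = ± 1`. -/
theorem MistuningData.isTheEigenvalueBranch {k₀ κ M b₀ E σ : ℝ} {km ks ν : ℝ → ℝ} {N : ℕ}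
    (H : MistuningData k₀ κ M km ks) (hN : 0 < N) (hEM : E * M ≤ k₀)
    (hσ : σ ^ 2 = 1) (hνc : ContinuousOn ν (Icc 0 E))
    (hν : ∀ ε ∈ Icc 0 E, ∀ lam,
      endAngle k₀ κ (meanDensity N) km ks ε lam = κ * (2 * π) ↔ lam = ν ε)
    (hD : ∀ ε ∈ Icc 0 E, 0 < b₀ ^ 2 - 4 * (ν ε / meanDensity N ^ 2)) :
    IsTheEigenvalueBranch b₀ k₀ km ks N
      (((-b₀ + σ * √(b₀ ^ 2 - 4 * (ν 0 / meanDensity N ^ 2))) / 2 : ℝ) : ℂ) E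
      fun ε => (((-b₀ + σ * √(b₀ ^ 2 - 4 * (ν ε / meanDensity N ^ 2))) / 2 : ℝ) : ℂ) := by
  have hρ := meanDensity_pos hN
  set ρ := meanDensity N with hρdef
  have hM := H.bound_pos
  have hρ' : (ρ : ℂ) ≠ 0 := Complex.ofReal_ne_zero.2 hρ.ne'
  have hsc : ContinuousOn (fun ε => √(b₀ ^ 2 - 4 * (ν ε / ρ ^ 2))) (Icc 0 E) :=
    (continuousOn_const.sub (continuousOn_const.mul (hνc.div_const _))).sqrt
  have hεM : ∀ ε ∈ Icc 0 E, 0 ≤ ε ∧ ε * M ≤ k₀ := fun ε hε =>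
    ⟨hε.1, (mul_le_mul_of_nonneg_right hε.2 hM.le).trans hEM⟩
  have hroot : ∀ ε ∈ Icc 0 E, ρ ^ 2 * (((-b₀ + σ * √(b₀ ^ 2 - 4 * (ν ε / ρ ^ 2))) / 2) ^ 2 +
      b₀ * ((-b₀ + σ * √(b₀ ^ 2 - 4 * (ν ε / ρ ^ 2))) / 2)) = -ν ε := by
    intro ε hε
    have h1 := Real.sq_sqrt (hD ε hε).le
    have h2 : ρ ^ 2 * (ν ε / ρ ^ 2) = ν ε := by field_simp
    linear_combination ρ ^ 2 / 4 * √(b₀ ^ 2 - 4 * (ν ε / ρ ^ 2)) ^ 2 * hσ + ρ ^ 2 / 4 * h1 - h2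
  refine ⟨⟨?_, rfl, fun ε hε => ?_⟩, fun E' hE'0 hE' t ht => ?_⟩
  · exact Complex.continuous_ofReal.comp_continuousOn
      ((continuousOn_const.add (continuousOn_const.mul hsc)).div_const 2)
  · obtain ⟨hε0, hεk⟩ := hεM ε hε
    obtain ⟨θ, hθ, e⟩ := H.exists_angle hε0 hεk ρ (ν ε)
    refine isDirichletEigenvalue_of_sin_eq_zero hN H.κ_pos H.measurable_km H.measurable_ks
      H.abs_km_le (half_pos H.k₀_pos) (H.le_stiffness hε0 hεk) ?_ hθ ?_
    · exact_mod_cast congrArg (fun r : ℝ => (r : ℂ)) (hroot ε hε)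
    · rw [e, (hν ε hε _).2 rfl, H.sin_eq_zero]
  · have hsub : Icc 0 E' ⊆ Icc 0 E := Icc_subset_Icc_right hE'
    -- The spectral parameter of an arbitrary competing branch `t`; it is real and continuous.
    set g : ℝ → ℝ := fun ε => -((ρ : ℂ) ^ 2 * (t ε ^ 2 + b₀ * t ε)).re with hg
    have htc := ht.continuousOn
    have hgc : ContinuousOn g (Icc 0 E') :=
      (Complex.continuous_re.comp_continuousOn
        (continuousOn_const.mul ((htc.pow 2).add (continuousOn_const.mul htc)))).neg
    have hspec : ∀ ε ∈ Icc 0 E', (ρ : ℂ) ^ 2 * (t ε ^ 2 + b₀ * t ε) = -(g ε : ℂ) ∧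
        sin (endAngle k₀ κ ρ km ks ε (g ε)) = 0 := by
      intro ε hε
      obtain ⟨hε0, hεk⟩ := hεM ε (hsub hε)
      obtain ⟨lam, h1, h2⟩ := (ht.isEigenvalue ε hε).spectralParameter hN H.κ_pos
        H.measurable_km H.measurable_ks H.abs_km_le (half_pos H.k₀_pos)
        (H.le_stiffness hε0 hεk) (H.stiffness_le hε0 hεk)
      have h3 : g ε = lam := by
        simp only [hg, hρdef, h1]
        simp
      rw [h3]
      obtain ⟨θ, hθ, e⟩ := H.exists_angle hε0 hεk ρ lam
      exact ⟨h1, e ▸ h2 θ hθ⟩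
    have hfc := H.continuousOn_endAngle ρ (fun ε hε => hεM ε (hsub hε)) hgc
    have h0mem : (0 : ℝ) ∈ Icc 0 E' := ⟨le_rfl, hE'0.le⟩
    have hg0 : g 0 = ν 0 := by
      have h1 := (hspec 0 h0mem).1
      rw [ht.start] at h1
      have h2 := hroot 0 (hsub h0mem)
      have h3 : -g 0 = -ν 0 := by
        rw [← h2]
        exact_mod_cast h1.symm
      linarith
    -- A continuous function on an interval with values in the discrete group `π ℤ` is constant, so
    -- the competing branch keeps the end angle `2 π κ`.
    have hmaps : MapsTo (fun ε => endAngle k₀ κ ρ km ks ε (g ε)) (Icc 0 E')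
        (AddSubgroup.zmultiples π : Set ℝ) := by
      intro ε hε
      obtain ⟨n, hn⟩ := sin_eq_zero_iff.1 (hspec ε hε).2
      exact ⟨n, by simpa using hn⟩
    have hgν : ∀ ε ∈ Icc 0 E', g ε = ν ε := by
      intro ε hε
      have h1 : endAngle k₀ κ ρ km ks ε (g ε) = endAngle k₀ κ ρ km ks 0 (g 0) :=
        isPreconnected_Icc.constant_of_mapsTo
        ⟨(inferInstance : DiscreteTopology (AddSubgroup.zmultiples π))⟩ hfc hmaps hε h0mem
      rw [hg0, (hν 0 (hsub h0mem) _).2 rfl] at h1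
      exact (hν ε (hsub hε) _).1 h1
    have hσ0 : σ ≠ 0 := by rintro rfl; norm_num at hσ
    have hne : ∀ ε ∈ Icc 0 E', ((σ * √(b₀ ^ 2 - 4 * (ν ε / ρ ^ 2)) : ℝ) : ℂ) ≠ 0 := fun ε hε =>
      Complex.ofReal_ne_zero.2 (mul_ne_zero hσ0 (Real.sqrt_pos.2 (hD ε (hsub hε))).ne')
    -- Both sides are continuous with the same nonvanishing square; on a connected set the sign is
    -- decided at `ε = 0`.
    have hEq : EqOn (fun ε => 2 * t ε + b₀)
        (fun ε => ((σ * √(b₀ ^ 2 - 4 * (ν ε / ρ ^ 2)) : ℝ) : ℂ)) (Icc 0 E') := by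
      refine isPreconnected_Icc.eq_of_sq_eq ((continuousOn_const.mul htc).add continuousOn_const)
        (Complex.continuous_ofReal.comp_continuousOn
          (continuousOn_const.mul (hsc.mono hsub))) ?_ (fun {x} hx => hne x hx) h0mem ?_
      · intro ε hε
        have h1 := (hspec ε hε).1
        rw [hgν ε hε] at h1
        have h2 : (ρ : ℂ) ^ 2 * (((-b₀ + σ * √(b₀ ^ 2 - 4 * (ν ε / ρ ^ 2))) / 2) ^ 2 +
            b₀ * ((-b₀ + σ * √(b₀ ^ 2 - 4 * (ν ε / ρ ^ 2))) / 2)) = -(ν ε : ℂ) := by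
          exact_mod_cast congrArg (fun r : ℝ => (r : ℂ)) (hroot ε (hsub hε))
        have h3 := mul_left_cancel₀ (pow_ne_zero 2 hρ') (h1.trans h2.symm)
        simp only [Pi.pow_apply]
        push_cast
        linear_combination 4 * h3
      · simp only [ht.start]
        push_cast
        ring
    intro ε hε
    have h1 := hEq hε
    simp only at h1 ⊢
    push_cast at h1 ⊢
    linear_combination h1 / 2

/-! ### Asymptotics of the eigenvalues, uniformly in `N` -/

/-- Second order Taylor bound for the square root away from zero. -/
theorem abs_sqrt_sub_sqrt_sub_le {m x y : ℝ} (hm : 0 < m) (hx : m / 2 ≤ √x) (hy : m / 2 ≤ √y)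
    (hx0 : 0 ≤ x) (hy0 : 0 ≤ y) : |√x - √y - (x - y) / (2 * √y)| ≤ (x - y) ^ 2 / m ^ 3 := by
  have hx' : 0 < √x := by linarith
  have hy' : 0 < √y := by linarith
  have e : x - y = (√x - √y) * (√x + √y) := by
    linear_combination -(Real.sq_sqrt hx0) + Real.sq_sqrt hy0
  have h1 : √x - √y - (x - y) / (2 * √y) = -((x - y) ^ 2 / (2 * √y * (√x + √y) ^ 2)) := by
    rw [e]
    field_simp
    ring
  rw [h1, abs_neg, abs_of_nonneg (by positivity)]
  gcongr
  calc m ^ 3 = 2 * (m / 2) * (m / 2 + m / 2) ^ 2 := by ring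
    _ ≤ 2 * √y * (√x + √y) ^ 2 := by gcongr

theorem nominalPlus_eq {b₀ k₀ D : ℝ} {N l : ℕ} (hD : b₀ ^ 2 - waveSpeedSq k₀ N * (l : ℝ) ^ 2 = D)
    (hD0 : 0 ≤ D) : nominalPlus b₀ k₀ N l = (((-b₀ + √D) / 2 : ℝ) : ℂ) := by
  have h1 := Complex.ofReal_cpow hD0 (1 / 2)
  rw [nominalPlus, hD, Real.sqrt_eq_rpow]
  push_cast at h1 ⊢
  rw [h1]

theorem nominalMinus_eq {b₀ k₀ D : ℝ} {N l : ℕ} (hD : b₀ ^ 2 - waveSpeedSq k₀ N * (l : ℝ) ^ 2 = D)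
    (hD0 : 0 ≤ D) : nominalMinus b₀ k₀ N l = (((-b₀ - √D) / 2 : ℝ) : ℂ) := by
  have h1 := Complex.ofReal_cpow hD0 (1 / 2)
  rw [nominalMinus, hD, Real.sqrt_eq_rpow]
  push_cast at h1 ⊢
  rw [h1]

theorem mistuningCoeff_eq {b₀ : ℝ} (hb₀ : 0 < b₀) (km : ℝ → ℝ) {N : ℕ} (hN : 0 < N) (l : ℕ) :
    mistuningCoeff b₀ km N l = -(dampingCoeff ((l : ℝ) / 2) km / meanDensity N) / b₀ := by
  have hN' : (0 : ℝ) < N := by exact_mod_cast hN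
  have h1 : ∀ x : ℝ, km x * (sin ((l : ℝ) / 2 * x) * cos ((l : ℝ) / 2 * x)) =
      1 / 2 * (km x * sin (l * x)) := by
    intro x
    have : (l : ℝ) * x = 2 * ((l : ℝ) / 2 * x) := by ring
    rw [this, sin_two_mul]
    ring
  simp only [mistuningCoeff, dampingCoeff, h1, meanDensity, intervalIntegral.integral_const_mul]
  field_simp

theorem mistuningCoeff_congr {b₀ : ℝ} {km km' : ℝ → ℝ}
    (h : km =ᵐ[volume.restrict (Icc 0 (2 * π))] km') (N l : ℕ) :
    mistuningCoeff b₀ km N l = mistuningCoeff b₀ km' N l := by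
  rw [mistuningCoeff, mistuningCoeff]
  congr 1
  refine intervalIntegral.integral_congr_ae ?_
  rw [Filter.EventuallyEq, ae_restrict_iff' measurableSet_Icc] at h
  filter_upwards [h] with x hx hx'
  rw [uIoc_of_le (by positivity)] at hx'
  rw [hx (Ioc_subset_Icc_self hx')]

/-- Bounded profiles have representatives that are measurable and bounded everywhere. -/
theorem exists_measurable_bounded {f : ℝ → ℝ}
    (hf : MemLp f ⊤ (volume.restrict (Icc 0 (2 * π)))) : ∃ (g : ℝ → ℝ) (M : ℝ), 0 < M ∧
      Measurable g ∧ (∀ x, |g x| ≤ M) ∧ f =ᵐ[volume.restrict (Icc 0 (2 * π))] g := by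
  have hg := hf.1.aemeasurable
  set C : ℝ := (eLpNormEssSup f (volume.restrict (Icc 0 (2 * π)))).toReal with hC
  have hC0 : 0 ≤ C := ENNReal.toReal_nonneg
  have hfin : eLpNormEssSup f (volume.restrict (Icc 0 (2 * π))) ≠ ⊤ := by
    have := hf.2
    rw [eLpNorm_exponent_top] at this
    exact this.ne
  -- Truncation at the essential supremum; the bound is `C + 1` because `C` may be zero.
  refine ⟨fun x => max (-C) (min C (hg.mk f x)), C + 1, by linarith, ?_, fun x => ?_, ?_⟩
  · exact measurable_const.max (measurable_const.min hg.measurable_mk)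
  · rw [abs_le]
    exact ⟨(by linarith : -(C + 1) ≤ -C).trans (le_max_left _ _),
      max_le (by linarith) ((min_le_left _ _).trans (by linarith))⟩
  · filter_upwards [hg.ae_eq_mk, ae_le_eLpNormEssSup (f := f)] with x h1 h2
    have h3 : |f x| ≤ C := by
      have := ENNReal.toReal_mono hfin h2
      rwa [toReal_enorm] at this
    rw [← h1, min_eq_right (abs_le.1 h3).2, max_eq_right (abs_le.1 h3).1]

/-- Expansion of `√(b² - 4 m)` along a perturbation `m = m₀ + ε q + O(ε²)`. -/
theorem sqrt_discriminant_expansion {b B K m₀ m q ε : ℝ} (hb : 0 < b) (hK : 0 ≤ K)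
    (hm₀ : 16 * m₀ ≤ b ^ 2) (hε : 0 ≤ ε) (hε1 : ε ≤ 1) (hεb : (B + K) * ε ≤ b ^ 2 / 16)
    (hq : |q| ≤ B) (hm : |m - m₀ - ε * q| ≤ K * ε ^ 2) :
    0 < b ^ 2 - 4 * m ∧
      |√(b ^ 2 - 4 * m) - √(b ^ 2 - 4 * m₀) - ε * (-2 * q / √(b ^ 2 - 4 * m₀))| ≤
        (16 * (B + K) ^ 2 / b ^ 3 + 8 * K / b) * ε ^ 2 := by
  have hεq : |ε * q| ≤ B * ε := by
    rw [abs_mul, abs_of_nonneg hε, mul_comm]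
    gcongr
  have hmm : |m - m₀| ≤ (B + K) * ε := by
    have h1 : m - m₀ = (m - m₀ - ε * q) + ε * q := by ring
    have h2 : K * ε ^ 2 ≤ K * ε := by
      gcongr
      nlinarith
    rw [h1]
    exact (abs_add_le _ _).trans (by linarith)
  have hmm' := abs_le.1 hmm
  have hb2 : 0 < b ^ 2 := by positivity
  -- The nominal value `m₀` and the perturbation each cost at most `b² / 4` of the discriminant.
  have hD : b ^ 2 / 4 ≤ b ^ 2 - 4 * m := by linarith
  have hD₀ : b ^ 2 / 4 ≤ b ^ 2 - 4 * m₀ := by linarith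
  have hs : b / 2 ≤ √(b ^ 2 - 4 * m) := Real.le_sqrt_of_sq_le (by linarith [hD])
  have hs₀ : b / 2 ≤ √(b ^ 2 - 4 * m₀) := Real.le_sqrt_of_sq_le (by linarith [hD₀])
  refine ⟨by linarith, ?_⟩
  have hT := abs_sqrt_sub_sqrt_sub_le hb hs hs₀ (by linarith) (by linarith)
  set r := √(b ^ 2 - 4 * m₀) with hr
  have hr0 : 0 < r := by linarith
  have e : √(b ^ 2 - 4 * m) - r - ε * (-2 * q / r) =
      (√(b ^ 2 - 4 * m) - r - (b ^ 2 - 4 * m - (b ^ 2 - 4 * m₀)) / (2 * r)) +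
        -(2 * (m - m₀ - ε * q) / r) := by
    field_simp
    ring
  have h1 : (b ^ 2 - 4 * m - (b ^ 2 - 4 * m₀)) ^ 2 / b ^ 3 ≤
      16 * (B + K) ^ 2 / b ^ 3 * ε ^ 2 := by
    have h2 : (m - m₀) ^ 2 ≤ ((B + K) * ε) ^ 2 := sq_le_sq' hmm'.1 hmm'.2
    calc (b ^ 2 - 4 * m - (b ^ 2 - 4 * m₀)) ^ 2 / b ^ 3 = 16 * (m - m₀) ^ 2 / b ^ 3 := by ring
      _ ≤ 16 * ((B + K) * ε) ^ 2 / b ^ 3 := by gcongr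
      _ = _ := by ring
  have h3 : |2 * (m - m₀ - ε * q) / r| ≤ 8 * K / b * ε ^ 2 := by
    rw [abs_div, abs_of_pos hr0, abs_mul, abs_two]
    calc 2 * |m - m₀ - ε * q| / r ≤ 2 * (K * ε ^ 2) / (b / 2) := by gcongr
      _ = 4 * K / b * ε ^ 2 := by field_simp; ring
      _ ≤ 8 * K / b * ε ^ 2 := by gcongr; norm_num
  rw [e, add_mul]
  refine (abs_add_le _ _).trans (add_le_add (hT.trans h1) ?_)
  rwa [abs_neg]

/-- Here `r` is the root `√D₀` of the nominal discriminant. Replacing `r` by `b₀` costs `b₀ - r =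
O(m₀) = O(1 / ρ²)`, and the stiffness term `b / ρ²` is of that order already. -/
theorem abs_rate_sub_le {b₀ ρ m₀ r G : ℝ} (hb₀ : 0 < b₀) (hρ : 1 ≤ ρ) (hr : b₀ / 2 ≤ r)
    (hr' : r ≤ b₀) (hgap : b₀ - r ≤ 4 * m₀ / b₀) (hm₀ : m₀ = G / ρ ^ 2) (a b : ℝ) :
    |-(a / ρ + b / ρ ^ 2) / r - -(a / ρ) / b₀| ≤
      (2 * |b| / b₀ + 8 * |a| * G / b₀ ^ 3) / ρ ^ 2 := by
  have hr0 : 0 < r := by linarith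
  have hρ0 : 0 < ρ := by linarith
  have e : -(a / ρ + b / ρ ^ 2) / r - -(a / ρ) / b₀ =
      -(a / ρ * ((b₀ - r) / (b₀ * r))) + -(b / ρ ^ 2 / r) := by
    field_simp
    ring
  have hgap0 : 0 ≤ b₀ - r := by linarith
  have h1 : |a / ρ * ((b₀ - r) / (b₀ * r))| ≤ 8 * |a| * G / b₀ ^ 3 / ρ ^ 2 := by
    have h3 : |(b₀ - r) / (b₀ * r)| = (b₀ - r) / (b₀ * r) := abs_of_nonneg (by positivity)
    rw [abs_mul, abs_div, abs_of_pos hρ0, h3]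
    calc |a| / ρ * ((b₀ - r) / (b₀ * r)) ≤ |a| * (4 * m₀ / b₀ / (b₀ * (b₀ / 2))) := by
          have h4 : 0 ≤ 4 * m₀ / b₀ := hgap0.trans hgap
          gcongr
          exact div_le_self (abs_nonneg _) hρ
      _ = _ := by rw [hm₀]; field_simp; ring
  have h2 : |b / ρ ^ 2 / r| ≤ 2 * |b| / b₀ / ρ ^ 2 := by
    rw [abs_div, abs_div, abs_of_pos hr0, abs_of_pos (pow_pos hρ0 2)]
    calc |b| / ρ ^ 2 / r ≤ |b| / ρ ^ 2 / (b₀ / 2) := by gcongr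
      _ = _ := by field_simp
  rw [e]
  refine (abs_add_le _ _).trans ?_
  rw [abs_neg, abs_neg, add_div]
  linarith

theorem mistuningData_of_bounded {k₀ M : ℝ} {km ks : ℝ → ℝ} {l : ℕ} (hk₀ : 0 < k₀) (hl : 1 ≤ l)
    (hM : 0 < M) (hkm : Measurable km) (hks : Measurable ks) (hkmb : ∀ x, |km x| ≤ M)
    (hksb : ∀ x, |ks x| ≤ M) : MistuningData k₀ ((l : ℝ) / 2) M km ks where
  k₀_pos := hk₀
  half_le := by
    have : (1 : ℝ) ≤ l := by exact_mod_cast hl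
    linarith
  sin_eq_zero := by
    rw [show (l : ℝ) / 2 * (2 * π) = l * π by ring]
    exact sin_nat_mul_pi l
  bound_pos := hM
  measurable_km := hkm
  measurable_ks := hks
  abs_km_le := hkmb
  abs_ks_le := hksb

set_option maxHeartbeats 1000000 in
/-- The pair of eigenvalue branches and its first order expansion, uniformly in `N`. -/
theorem MistuningData.exists_branches {b₀ k₀ M : ℝ} {km ks : ℝ → ℝ} {l : ℕ} (hb₀ : 0 < b₀)
    (H : MistuningData k₀ ((l : ℝ) / 2) M km ks) :
    ∃ ε₀ : ℝ, 0 < ε₀ ∧ ∃ N₀ : ℕ, 1 ≤ N₀ ∧ ∃ C : ℝ, 0 < C ∧ ∀ N : ℕ, N₀ ≤ N →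
      ∃ sp sm : ℝ → ℂ,
        IsTheEigenvalueBranch b₀ k₀ km ks N (nominalPlus b₀ k₀ N l) ε₀ sp ∧
        IsTheEigenvalueBranch b₀ k₀ km ks N (nominalMinus b₀ k₀ N l) ε₀ sm ∧
        ‖nominalPlus b₀ k₀ N l‖ ≤ C / (N : ℝ) ^ 2 ∧
        ‖nominalMinus b₀ k₀ N l + b₀‖ ≤ C / (N : ℝ) ^ 2 ∧
        ∃ rp rm : ℝ,
          |rp - mistuningCoeff b₀ km N l| ≤ C / (N : ℝ) ^ 2 ∧
          |rm + mistuningCoeff b₀ km N l| ≤ C / (N : ℝ) ^ 2 ∧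
          ∀ ε ∈ Icc 0 ε₀,
            ‖sp ε - (nominalPlus b₀ k₀ N l + ((ε * rp : ℝ) : ℂ))‖ ≤ C * ε ^ 2 ∧
            ‖sm ε - (nominalMinus b₀ k₀ N l + ((ε * rm : ℝ) : ℂ))‖ ≤ C * ε ^ 2 := by
  have hk₀ := H.k₀_pos
  have hM := H.bound_pos
  have hκ := H.κ_pos
  obtain ⟨K, hK, hbranch⟩ := H.exists_spectralBranch
  set κ : ℝ := (l : ℝ) / 2 with hκdef
  set a := dampingCoeff κ km with ha
  set b := stiffnessCoeff κ ks with hb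
  set B := |a| + |b| with hB
  have hB0 : 0 ≤ B := by positivity
  set R : ℝ := 1 + 16 * (k₀ * κ ^ 2) / b₀ ^ 2 with hR
  have hR1 : 1 ≤ R := le_add_of_nonneg_right (by positivity)
  -- The three entries keep the stiffness near `k₀`, allow `ε² ≤ ε`, and keep the discriminant
  -- positive; none depends on `N`. The constant `R` above makes `ρ ≥ R` imply `16 m₀ ≤ b₀²`.
  set ε₀ : ℝ := min (k₀ / M) (min 1 (b₀ ^ 2 / 16 / (B + K))) with hε₀
  have hε₀pos : 0 < ε₀ := by
    refine lt_min (by positivity) (lt_min one_pos (by positivity))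
  set C₁ : ℝ := 16 * (B + K) ^ 2 / b₀ ^ 3 + 8 * K / b₀ with hC₁
  set C₂ : ℝ := 2 * k₀ * κ ^ 2 / b₀ + 2 * |b| / b₀ + 8 * |a| * (k₀ * κ ^ 2) / b₀ ^ 3 with hC₂
  have hC₁0 : 0 < C₁ := by positivity
  have hC₂0 : 0 < C₂ := by positivity
  refine ⟨ε₀, hε₀pos, ⌈2 * π * R⌉₊, Nat.one_le_ceil_iff.2 (by positivity),
    C₁ + C₂ * (2 * π) ^ 2, by positivity, fun N hN => ?_⟩
  have hNR : 2 * π * R ≤ N := Nat.ceil_le.1 hN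
  have hNpos : 0 < N := by
    have : (0 : ℝ) < N := lt_of_lt_of_le (by positivity) hNR
    exact_mod_cast this
  have hNpos' : (0 : ℝ) < N := by exact_mod_cast hNpos
  set ρ := meanDensity N with hρ
  have hRρ : R ≤ ρ := by
    rw [hρ, meanDensity, le_div_iff₀ (by positivity)]
    linarith
  have hρ1 : 1 ≤ ρ := hR1.trans hRρ
  have hρ0 : 0 < ρ := by linarith
  have hNρ : C₂ / ρ ^ 2 ≤ (C₁ + C₂ * (2 * π) ^ 2) / (N : ℝ) ^ 2 := by
    have : C₂ / ρ ^ 2 = C₂ * (2 * π) ^ 2 / (N : ℝ) ^ 2 := by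
      rw [hρ, meanDensity]
      field_simp
    rw [this]
    gcongr
    linarith
  obtain ⟨ν, hνc, hν0, hν⟩ := hbranch ρ hρ1
  set m₀ := k₀ * κ ^ 2 / ρ ^ 2 with hm₀
  have hm₀0 : 0 ≤ m₀ := by positivity
  have hm₀le : 16 * m₀ ≤ b₀ ^ 2 := by
    have h1 : 16 * (k₀ * κ ^ 2) / b₀ ^ 2 ≤ ρ ^ 2 := by nlinarith
    rw [div_le_iff₀ (by positivity)] at h1
    rw [hm₀, ← mul_div_assoc, div_le_iff₀ (by positivity)]
    linarith
  set q := a / ρ + b / ρ ^ 2 with hq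
  have hqB : |q| ≤ B := by
    refine (abs_add_le _ _).trans (add_le_add ?_ ?_)
    · rw [abs_div, abs_of_pos hρ0]
      exact div_le_self (abs_nonneg _) hρ1
    · rw [abs_div, abs_of_pos (pow_pos hρ0 2)]
      exact div_le_self (abs_nonneg _) (one_le_pow₀ hρ1)
  have hdom : ∀ ε ∈ Icc 0 ε₀, 0 ≤ ε ∧ ε * M ≤ k₀ := fun ε hε => ⟨hε.1, by
    rw [← le_div_iff₀ hM]
    exact hε.2.trans (min_le_left _ _)⟩
  set D₀ := b₀ ^ 2 - 4 * m₀ with hD₀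
  set D : ℝ → ℝ := fun ε => b₀ ^ 2 - 4 * (ν ε / ρ ^ 2) with hD
  have hexp : ∀ ε ∈ Icc 0 ε₀, 0 < D ε ∧
      |√(D ε) - √D₀ - ε * (-2 * q / √D₀)| ≤ C₁ * ε ^ 2 := by
    intro ε hε
    refine sqrt_discriminant_expansion hb₀ hK.le hm₀le hε.1 ?_ ?_ hqB ?_
    · exact hε.2.trans ((min_le_right _ _).trans (min_le_left _ _))
    · rw [← le_div_iff₀' (by positivity)]
      exact hε.2.trans ((min_le_right _ _).trans (min_le_right _ _))
    · have h1 := (hν ε (hdom ε hε).1 (hdom ε hε).2).2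
      -- Dividing the expansion of `ν` by `ρ²` turns the error `K (ε ρ)²` into `K ε²`, so the bound
      -- becomes uniform in `N`.
      have h2 : ν ε / ρ ^ 2 - m₀ - ε * q =
          (ν ε - k₀ * κ ^ 2 - ε * ρ * a - ε * b) / ρ ^ 2 := by
        simp only [hm₀, hq]
        field_simp
        ring
      rw [h2, abs_div, abs_of_pos (pow_pos hρ0 2), div_le_iff₀ (by positivity)]
      linarith
  have hwave : b₀ ^ 2 - waveSpeedSq k₀ N * (l : ℝ) ^ 2 = D₀ := by
    simp only [hD₀, hm₀, waveSpeedSq, ← hρ, hκdef]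
    field_simp
    ring
  have hD₀pos : 0 < D₀ := by linarith [(by positivity : 0 < b₀ ^ 2)]
  have hnp := nominalPlus_eq hwave hD₀pos.le
  have hnm := nominalMinus_eq hwave hD₀pos.le
  have hs₀ : b₀ / 2 ≤ √D₀ :=
    Real.le_sqrt_of_sq_le (by linarith [(by positivity : 0 < b₀ ^ 2)])
  have hs₀' : √D₀ ≤ b₀ := by
    rw [Real.sqrt_le_left hb₀.le]
    linarith
  have hr0 : 0 < √D₀ := by linarith
  have hgap : b₀ - √D₀ ≤ 4 * m₀ / b₀ := by
    rw [le_div_iff₀ hb₀]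
    have := Real.sq_sqrt hD₀pos.le
    nlinarith
  have hgap' : 0 ≤ b₀ - √D₀ := by linarith
  have hgapC : (b₀ - √D₀) / 2 ≤ (C₁ + C₂ * (2 * π) ^ 2) / (N : ℝ) ^ 2 := by
    refine le_trans ?_ hNρ
    calc (b₀ - √D₀) / 2 ≤ 4 * m₀ / b₀ / 2 := by gcongr
      _ = 2 * k₀ * κ ^ 2 / b₀ / ρ ^ 2 := by rw [hm₀]; field_simp; ring
      _ ≤ C₂ / ρ ^ 2 := by
        gcongr
        rw [hC₂, add_assoc]
        exact le_add_of_nonneg_right (by positivity)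
  have hbr (σ : ℝ) (hσ : σ ^ 2 = 1) := H.isTheEigenvalueBranch (b₀ := b₀) (σ := σ) hNpos
    (hdom ε₀ ⟨hε₀pos.le, le_rfl⟩).2 hσ (hνc.mono hdom)
    (fun ε hε => (hν ε (hdom ε hε).1 (hdom ε hε).2).1) (fun ε hε => (hexp ε hε).1)
  have hcoeff := mistuningCoeff_eq hb₀ km hNpos l
  rw [← hκdef, ← ha, ← hρ] at hcoeff
  have hrate : |-q / √D₀ - mistuningCoeff b₀ km N l| ≤
      (C₁ + C₂ * (2 * π) ^ 2) / (N : ℝ) ^ 2 := by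
    refine le_trans ?_ hNρ
    rw [hcoeff, hq]
    refine (abs_rate_sub_le (m₀ := m₀) (G := k₀ * κ ^ 2) hb₀ hρ1 hs₀ hs₀' hgap hm₀ a b).trans ?_
    gcongr
    rw [hC₂, add_assoc]
    exact le_add_of_nonneg_left (by positivity)
  have hC : C₁ ≤ C₁ + C₂ * (2 * π) ^ 2 := le_add_of_nonneg_right (by positivity)
  refine ⟨fun ε => (((-b₀ + 1 * √(D ε)) / 2 : ℝ) : ℂ),
    fun ε => (((-b₀ + -1 * √(D ε)) / 2 : ℝ) : ℂ), ?_, ?_, ?_, ?_, -q / √D₀, q / √D₀, hrate, ?_,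
    fun ε hε => ⟨?_, ?_⟩⟩
  · convert! hbr 1 (by norm_num) using 1
    rw [hnp, hν0, one_mul]
  · convert! hbr (-1) (by norm_num) using 1
    rw [hnm, hν0, neg_one_mul, sub_eq_add_neg]
  · rw [hnp, Complex.norm_real, Real.norm_eq_abs, abs_le]
    constructor <;> linarith
  · rw [hnm, ← Complex.ofReal_add, Complex.norm_real, Real.norm_eq_abs, abs_le]
    constructor <;> linarith
  · rw [← abs_neg]
    convert hrate using 2
    ring
  · have h1 := (hexp ε hε).2
    beta_reduce
    rw [hnp, ← Complex.ofReal_add, ← Complex.ofReal_sub, Complex.norm_real, Real.norm_eq_abs]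
    have e : (-b₀ + 1 * √(D ε)) / 2 - ((-b₀ + √D₀) / 2 + ε * (-q / √D₀)) =
        (√(D ε) - √D₀ - ε * (-2 * q / √D₀)) / 2 := by ring
    rw [e, abs_div, abs_two]
    have h2 : 0 ≤ ε ^ 2 := sq_nonneg _
    have h3 := mul_le_mul_of_nonneg_right hC h2
    have h4 := abs_nonneg (√(D ε) - √D₀ - ε * (-2 * q / √D₀))
    linarith
  · have h1 := (hexp ε hε).2
    beta_reduce
    rw [hnm, ← Complex.ofReal_add, ← Complex.ofReal_sub, Complex.norm_real, Real.norm_eq_abs]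
    have e : (-b₀ + -1 * √(D ε)) / 2 - ((-b₀ - √D₀) / 2 + ε * (q / √D₀)) =
        -(√(D ε) - √D₀ - ε * (-2 * q / √D₀)) / 2 := by ring
    rw [e, abs_div, abs_two, abs_neg]
    have h2 : 0 ≤ ε ^ 2 := sq_nonneg _
    have h3 := mul_le_mul_of_nonneg_right hC h2
    have h4 := abs_nonneg (√(D ε) - √D₀ - ε * (-2 * q / √D₀))
    linarith

end Platoon

/-! ### Assembly of the theorem -/

theorem mainTheorem3 (b₀ k₀ : ℝ) (hb₀ : 0 < b₀) (hk₀ : 0 < k₀) (km ks : ℝ → ℝ)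
    (hkm : MemLp km ⊤ (volume.restrict (Icc 0 (2 * π))))
    (hks : MemLp ks ⊤ (volume.restrict (Icc 0 (2 * π))))
    (l : ℕ) (hl : 1 ≤ l) :
    ∃ ε₀ : ℝ, 0 < ε₀ ∧ ∃ N₀ : ℕ, 1 ≤ N₀ ∧ ∃ C : ℝ, 0 < C ∧ ∀ N : ℕ, N₀ ≤ N →
      -- the `l`-th eigenvalue pair `s_l^±(ε)`, and the same pair `t_l^±(ε)` for `k_s = 0`
      ∃ sp sm tp tm : ℝ → ℂ,
        Platoon.IsTheEigenvalueBranch b₀ k₀ km ks N (Platoon.nominalPlus b₀ k₀ N l) ε₀ sp ∧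
        Platoon.IsTheEigenvalueBranch b₀ k₀ km ks N (Platoon.nominalMinus b₀ k₀ N l) ε₀ sm ∧
        Platoon.IsTheEigenvalueBranch b₀ k₀ km 0 N (Platoon.nominalPlus b₀ k₀ N l) ε₀ tp ∧
        Platoon.IsTheEigenvalueBranch b₀ k₀ km 0 N (Platoon.nominalMinus b₀ k₀ N l) ε₀ tm ∧
        -- asymptotic formulas, uniformly in `ε` and `N`
        (∀ ε ∈ Icc 0 ε₀,
          ‖sp ε - ((ε * Platoon.mistuningCoeff b₀ km N l : ℝ) : ℂ)‖
              ≤ C * ε ^ 2 + C / (N : ℝ) ^ 2 ∧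
          ‖sm ε - ((-b₀ - ε * Platoon.mistuningCoeff b₀ km N l : ℝ) : ℂ)‖
              ≤ C * ε ^ 2 + C / (N : ℝ) ^ 2) ∧
        -- first-order expansions in `ε`, uniformly in `N`, whose linear coefficients are
        -- `± mistuningCoeff` up to `O(1 / N²)`
        (∃ rp rm : ℝ,
          |rp - Platoon.mistuningCoeff b₀ km N l| ≤ C / (N : ℝ) ^ 2 ∧
          |rm + Platoon.mistuningCoeff b₀ km N l| ≤ C / (N : ℝ) ^ 2 ∧
          ∀ ε ∈ Icc 0 ε₀,
            ‖sp ε - (Platoon.nominalPlus b₀ k₀ N l + ((ε * rp : ℝ) : ℂ))‖ ≤ C * ε ^ 2 ∧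
            ‖sm ε - (Platoon.nominalMinus b₀ k₀ N l + ((ε * rm : ℝ) : ℂ))‖ ≤ C * ε ^ 2) ∧
        -- `k_s` affects the part of first order in `ε` only at order `1 / N²`
        (∀ ε ∈ Icc 0 ε₀,
          ‖sp ε - tp ε‖ ≤ C * ε / (N : ℝ) ^ 2 + C * ε ^ 2 ∧
          ‖sm ε - tm ε‖ ≤ C * ε / (N : ℝ) ^ 2 + C * ε ^ 2) := by
  -- Eigenvalues and `mistuningCoeff` see the profiles only almost everywhere on `[0, 2π]`, so
  -- bounded measurable representatives may be used.
  obtain ⟨km', M₁, hM₁, hkm'm, hkm'b, hkm'⟩ := Platoon.exists_measurable_bounded hkm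
  obtain ⟨ks', M₂, -, hks'm, hks'b, hks'⟩ := Platoon.exists_measurable_bounded hks
  obtain ⟨ε₁, hε₁, N₁, hN₁, C₁, hC₁, H₁⟩ :=
    (Platoon.mistuningData_of_bounded hk₀ hl (hM₁.trans_le (le_max_left M₁ M₂)) hkm'm hks'm
      (fun x => (hkm'b x).trans (le_max_left _ _))
      (fun x => (hks'b x).trans (le_max_right _ _))).exists_branches hb₀
  obtain ⟨ε₂, hε₂, N₂, -, C₂, hC₂, H₂⟩ :=
    (Platoon.mistuningData_of_bounded hk₀ hl hM₁ hkm'm (measurable_zero (α := ℝ)) hkm'b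
      (fun x => by simpa using hM₁.le)).exists_branches hb₀
  -- The factor `1 + ε₁` absorbs the term `ε |r - d| ≤ ε₁ C₁ / N²` that arises when the exact rate
  -- is replaced by `± mistuningCoeff`.
  set C := (C₁ + C₂) * (1 + ε₁) with hC
  have hC₁C : C₁ ≤ C := by rw [hC]; nlinarith [mul_pos hC₁ hε₁, mul_pos hC₂ hε₁]
  have hC₁₂C : C₁ + C₂ ≤ C := by rw [hC]; nlinarith [mul_pos hC₁ hε₁, mul_pos hC₂ hε₁]
  have hC₁εC : C₁ + ε₁ * C₁ ≤ C := by rw [hC]; nlinarith [mul_pos hC₂ hε₁]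
  refine ⟨min ε₁ ε₂, lt_min hε₁ hε₂, max N₁ N₂, hN₁.trans (le_max_left _ _), C,
    by linarith, fun N hN => ?_⟩
  obtain ⟨sp, sm, hsp, hsm, hnp, hnm, rp, rm, hrp, hrm, hexp⟩ :=
    H₁ N ((le_max_left _ _).trans hN)
  obtain ⟨tp, tm, htp, htm, -, -, qp, qm, hqp, hqm, hexp'⟩ :=
    H₂ N ((le_max_right _ _).trans hN)
  rw [← Platoon.mistuningCoeff_congr hkm'] at hrp hrm hqp hqm
  set c := Platoon.mistuningCoeff b₀ km N l with hc
  have hN0 : (0 : ℝ) < N := by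
    have : 1 ≤ N := hN₁.trans ((le_max_left _ _).trans hN)
    exact_mod_cast this
  have hN2 : (0 : ℝ) < (N : ℝ) ^ 2 := by positivity
  have hfirst : ∀ {z n w : ℂ} {ε r : ℝ}, ε ∈ Icc 0 (min ε₁ ε₂) → ∀ d : ℝ,
      ‖z - (n + ((ε * r : ℝ) : ℂ))‖ ≤ C₁ * ε ^ 2 → ‖n - w‖ ≤ C₁ / (N : ℝ) ^ 2 →
      |r - d| ≤ C₁ / (N : ℝ) ^ 2 →
      ‖z - (w + ((ε * d : ℝ) : ℂ))‖ ≤ C * ε ^ 2 + C / (N : ℝ) ^ 2 := by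
    intro z n w ε r hε d h1 h2 h3
    have e : z - (w + ((ε * d : ℝ) : ℂ)) =
        (z - (n + ((ε * r : ℝ) : ℂ))) + (n - w) + ((ε * (r - d) : ℝ) : ℂ) := by
      push_cast
      ring
    have h4 : ‖((ε * (r - d) : ℝ) : ℂ)‖ ≤ ε₁ * (C₁ / (N : ℝ) ^ 2) := by
      rw [Complex.norm_real, Real.norm_eq_abs, abs_mul, abs_of_nonneg hε.1]
      exact mul_le_mul (hε.2.trans (min_le_left _ _)) h3 (abs_nonneg _) hε₁.le
    have h5 : C₁ / (N : ℝ) ^ 2 + ε₁ * (C₁ / (N : ℝ) ^ 2) ≤ C / (N : ℝ) ^ 2 := by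
      rw [← mul_div_assoc, ← add_div]
      gcongr
    have h6 : C₁ * ε ^ 2 ≤ C * ε ^ 2 := by gcongr
    rw [e]
    linarith [norm_add₃_le (a := z - (n + ((ε * r : ℝ) : ℂ))) (b := n - w)
      (c := ((ε * (r - d) : ℝ) : ℂ))]
  -- The branches with and without `k_s` start at the same `n`, and both rates are within `O(1 /
  -- N²)` of the same `d`, since `mistuningCoeff` does not involve `k_s`.
  have hdiff : ∀ {z z' n : ℂ} {ε r r' d : ℝ}, 0 ≤ ε →
      ‖z - (n + ((ε * r : ℝ) : ℂ))‖ ≤ C₁ * ε ^ 2 → ‖z' - (n + ((ε * r' : ℝ) : ℂ))‖ ≤ C₂ * ε ^ 2 →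
      |r - d| ≤ C₁ / (N : ℝ) ^ 2 → |r' - d| ≤ C₂ / (N : ℝ) ^ 2 →
      ‖z - z'‖ ≤ C * ε / (N : ℝ) ^ 2 + C * ε ^ 2 := by
    intro z z' n ε r r' d hε h1 h2 h3 h4
    have e : z - z' = (z - (n + ((ε * r : ℝ) : ℂ))) + -(z' - (n + ((ε * r' : ℝ) : ℂ))) +
        ((ε * ((r - d) - (r' - d)) : ℝ) : ℂ) := by
      push_cast
      ring
    have h5 : ‖((ε * ((r - d) - (r' - d)) : ℝ) : ℂ)‖ ≤ C * ε / (N : ℝ) ^ 2 := by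
      rw [Complex.norm_real, Real.norm_eq_abs, abs_mul, abs_of_nonneg hε]
      calc ε * |(r - d) - (r' - d)| ≤ ε * ((C₁ + C₂) / (N : ℝ) ^ 2) := by
            gcongr
            rw [add_div]
            exact (abs_sub _ _).trans (add_le_add h3 h4)
        _ ≤ ε * (C / (N : ℝ) ^ 2) := by gcongr
        _ = C * ε / (N : ℝ) ^ 2 := by ring
    have h6 : (C₁ + C₂) * ε ^ 2 ≤ C * ε ^ 2 := by gcongr
    have h7 := norm_add₃_le (a := z - (n + ((ε * r : ℝ) : ℂ)))
      (b := -(z' - (n + ((ε * r' : ℝ) : ℂ)))) (c := ((ε * ((r - d) - (r' - d)) : ℝ) : ℂ))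
    rw [norm_neg] at h7
    rw [e]
    linarith
  have hsub₁ : ∀ {ε}, ε ∈ Icc 0 (min ε₁ ε₂) → ε ∈ Icc 0 ε₁ := fun h =>
    ⟨h.1, h.2.trans (min_le_left _ _)⟩
  have hsub₂ : ∀ {ε}, ε ∈ Icc 0 (min ε₁ ε₂) → ε ∈ Icc 0 ε₂ := fun h =>
    ⟨h.1, h.2.trans (min_le_right _ _)⟩
  have hle : C₁ / (N : ℝ) ^ 2 ≤ C / (N : ℝ) ^ 2 := by gcongr
  have hrm' : |rm - -c| ≤ C₁ / (N : ℝ) ^ 2 := by rwa [sub_neg_eq_add]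
  have hqm' : |qm - -c| ≤ C₂ / (N : ℝ) ^ 2 := by rwa [sub_neg_eq_add]
  refine ⟨sp, sm, tp, tm, (hsp.congr hkm'.symm hks'.symm).mono (min_le_left _ _),
    (hsm.congr hkm'.symm hks'.symm).mono (min_le_left _ _),
    (htp.congr hkm'.symm Filter.EventuallyEq.rfl).mono (min_le_right _ _),
    (htm.congr hkm'.symm Filter.EventuallyEq.rfl).mono (min_le_right _ _),
    fun ε hε => ⟨?_, ?_⟩, ⟨rp, rm, hrp.trans hle, hrm.trans hle, fun ε hε => ?_⟩,
    fun ε hε => ⟨?_, ?_⟩⟩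
  · have h1 := hfirst (w := 0) hε c (hexp ε (hsub₁ hε)).1 (by rwa [sub_zero]) hrp
    rwa [zero_add] at h1
  · have h1 := hfirst (w := -(b₀ : ℂ)) hε (-c) (hexp ε (hsub₁ hε)).2 (by rwa [sub_neg_eq_add]) hrm'
    convert h1 using 3
    push_cast
    ring
  · obtain ⟨h1, h2⟩ := hexp ε (hsub₁ hε)
    have h3 : C₁ * ε ^ 2 ≤ C * ε ^ 2 := by gcongr
    exact ⟨h1.trans h3, h2.trans h3⟩
  · exact hdiff hε.1 (hexp ε (hsub₁ hε)).1 (hexp' ε (hsub₂ hε)).1 hrp hqp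
  · exact hdiff hε.1 (hexp ε (hsub₁ hε)).2 (hexp' ε (hsub₂ hε)).2 hrm' hqm'
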